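/- Let $G$ be a countably infinite (discrete) group and let $X$ be a Borel $G$-space, i.e. a standard Borel space with an action of $G$ by Borel automorphisms. Write $\mathcal B(X)$ for the Borel sets, $[A]_G=\bigcup_{g\in G}gA$, and call $X$ aperiodic if every $G$-orbit is infinite. Definitions. For a finite partition $\mathcal I$ of $X$ into Borel sets let $x\,F_{\mathcal I}\,y$ mean that for every $g\in G$ the points $gx$ and $gy$ lie in the same piece of $\mathcal I$. For an equivalence relation $E$, a set $S$ is $E$-invariant relative to $A$ if $[S]_E\cap A=S\cap A$. A partition $\mathcal I$ is $A$-sensitive if $A$ is $F_{\mathcal I}$-invariant relative to $[A]_G$. For Borel $A,B$ write $A\sim_{\mathcal I}B$ if there are $g_n\in G$ and partitions $\{A_n\}_{n\in\mathbb N}$ of $A$ and $\{B_n\}_{n\in\mathbb N}$ of $B$ into (possibly empty) Borel sets such that, for all $n$, $g_nA_n=B_n$, $A_n$ is $F_{\mathcal I}$-invariant relative to $A$, and $B_n$ is $F_{\mathcal I}$-invariant relative to $B$. For $i\ge 1$, a Borel set $A$ is $i^*$-compressible if there are a Borel set $B\subseteq A$ with $[A\setminus B]_G=[A]_G$ and Borel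 sets $F_0,\dots,F_{i-1}\subseteq X$ such that the partition $\mathcal I$ of $X$ generated by $F_0,\dots,F_{i-1}$ is $A$-sensitive, $A\sim_{\mathcal I}B$, and $B=F_k\cap[A]_G$ for some $k<i$. Let $$\mathfrak C_i=\{A\subseteq X:\ \text{there is a } G\text{-invariant } i^*\text{-compressible Borel set } P\supseteq A\}.$$ A property of points holds modulo $\mathfrak C_i$ if it holds for all $x\in X\setminus Z$, for some $Z\in\mathfrak C_i$. Theorem. (1) If $X$ is aperiodic, then there is a function $m:\mathcal B(X)\times X\to[0,1]$ such that for all $A,B\in\mathcal B(X)$: (a) $m(A,\cdot)$ is Borel; (b) $m(X,x)=1$ for all $x\in X$; (c) if $A\subseteq B$, then $m(A,x)\le m(B,x)$ for all $x\in X$; (d) $m(A,x)=0$ for all $x\notin[A]_G$; (e) modulo $\mathfrak C_4$, $m(A,x)>0$ for all $x\in[A]_G$; (f) modulo $\mathfrak C_3$, $m(A,x)=m(gA,x)$ for all $g\in G$ and $x\in X$; (g) if $A\cap B=\emptyset$, then modulo $\mathfrak C_4$, $m(A\cup B,x)=m(A,x)+m(B,x)$ for all $x\in X$. (2) Let $X$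 be any Borel $G$-space (not necessarily aperiodic), and let $\mathfrak B\subseteq\mathcal B(X)$ be a countable Boolean $G$-algebra, i.e. a countable family of Borel sets closed under finite unions, complements and the action of $G$. For every $A\in\mathfrak B$ with $A\notin\mathfrak C_4$ there is a $G$-invariant finitely additive probability measure $\mu$ on $\mathfrak B$ with $\mu(A)>0$; moreover, $\mu$ can be taken such that there is $x\in A$ with $\mu(B)=0$ for every $B\in\mathfrak B$ with $B\cap[x]_G=\emptyset$, where $[x]_G$ is the orbit of $x$. -/

import Mathlib

open scoped Pointwise

namespace CompressibleAction

/-- The saturation `[A]_E` of a set `A` under an equivalence relation `E`. -/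
def saturation {X : Type*} (E : Setoid X) (A : Set X) : Set X :=
  {x | ∃ y ∈ A, E x y}

/-- The saturation `[A]_G` of a set `A` under the orbit equivalence relation of the action. -/
def orbitSaturation (G : Type*) {X : Type*} [Group G] [MulAction G X] (A : Set X) : Set X :=
  saturation (MulAction.orbitRel G X) A

/-- The action is aperiodic: it has no finite orbit. -/
def IsAperiodic (G X : Type*) [Group G] [MulAction G X] : Prop :=
  ∀ x : X, (MulAction.orbit G x).Infinite

/-- A set is `G`-invariant. -/
def IsInvariantSet (G : Type*) {X : Type*} [Group G] [MulAction G X] (P : Set X) : Prop :=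
  ∀ g : G, g • P = P

/-- The finite partition of `X` generated by the sets `F 0, …, F (i - 1)`, given as the equivalence
relation of lying in the same piece: `x` and `y` belong to the same `F k`'s. -/
def generatedPartition {X : Type*} {i : ℕ} (F : Fin i → Set X) : Setoid X where
  r x y := ∀ k, x ∈ F k ↔ y ∈ F k
  iseqv :=
    { refl := fun _ _ => Iff.rfl
      symm := fun h k => (h k).symm
      trans := fun h h' k => (h k).trans (h' k) }

/-- For a partition `I` (given as the equivalence relation of lying in the same piece), the
equivalence relation `F_I` of not being separated by the translates of the pieces of `I`: for
every `g`, the points `g • x` and `g • y` lie in the same piece. In other words, `x` and `y` have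
the same symbolic representation with respect to `I`. -/
def notSeparated (G : Type*) {X : Type*} [Group G] [MulAction G X] (I : Setoid X) : Setoid X where
  r x y := ∀ g : G, I (g • x) (g • y)
  iseqv :=
    { refl := fun _ _ => I.refl _
      symm := fun h g => I.symm (h g)
      trans := fun h h' g => I.trans (h g) (h' g) }

/-- `A` is `E`-invariant relative to `B`. -/
def IsInvariantRelTo {X : Type*} (E : Setoid X) (A B : Set X) : Prop :=
  saturation E A ∩ B = A ∩ B

/-- The partition `I` is `A`-sensitive (`A` respects `I`): `A` is `F_I`-invariant relative to
`[A]_G`. -/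
def IsSensitive (G : Type*) {X : Type*} [Group G] [MulAction G X] (I : Setoid X) (A : Set X) :
    Prop :=
  IsInvariantRelTo (notSeparated G I) A (orbitSaturation G A)

/-- The sets `S n` form a partition of `A` indexed by `ℕ` (pieces may be empty). -/
def IsPartitionOf {X : Type*} (S : ℕ → Set X) (A : Set X) : Prop :=
  Pairwise (Function.onFun Disjoint S) ∧ ⋃ n, S n = A

/-- Borel sets `A` and `B` are `I`-equidecomposable (with Borel pieces): there are countable Borel
partitions `(S n)` of `A` and `(T n)` of `B` and group elements `g n` with `g n • S n = T n`, such
that every `S n` is `F_I`-invariant relative to `A` and every `T n` is `F_I`-invariant relative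
to `B`. -/
def IsEquidecomposable (G : Type*) {X : Type*} [Group G] [MulAction G X] [MeasurableSpace X]
    (I : Setoid X) (A B : Set X) : Prop :=
  ∃ (g : ℕ → G) (S T : ℕ → Set X),
    IsPartitionOf S A ∧ IsPartitionOf T B ∧
    ∀ n, g n • S n = T n ∧ MeasurableSet (S n) ∧ MeasurableSet (T n) ∧
      IsInvariantRelTo (notSeparated G I) (S n) A ∧
      IsInvariantRelTo (notSeparated G I) (T n) B

/-- The family `F` of `i` Borel sets witnesses that `A` and `B` are `i`-equidecomposable. -/
def WitnessesEquidecomposable (G : Type*) {X : Type*} [Group G] [MulAction G X]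
    [MeasurableSpace X] {i : ℕ} (F : Fin i → Set X) (A B : Set X) : Prop :=
  (∀ k, MeasurableSet (F k)) ∧ IsSensitive G (generatedPartition F) A ∧
    IsEquidecomposable G (generatedPartition F) A B

/-- The set `A` is `i*`-compressible: with `P = [A]_G`, there is a Borel `B ⊆ A` such that
`[A \ B]_G = P`, and `A` and `B` are `i`-equidecomposable as witnessed by a family `F` of `i` Borel
sets for which `B` is one of the traces `F k ∩ P`. -/
def IsStarCompressible (G : Type*) {X : Type*} [Group G] [MulAction G X] [MeasurableSpace X]
    (i : ℕ) (A : Set X) : Prop :=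
  MeasurableSet A ∧
    ∃ B ⊆ A, MeasurableSet B ∧ orbitSaturation G (A \ B) = orbitSaturation G A ∧
      ∃ F : Fin i → Set X, WitnessesEquidecomposable G F A B ∧
        ∃ k, B = F k ∩ orbitSaturation G A

/-- The `σ`-ideal `C_i` of all subsets of `G`-invariant Borel `i*`-compressible sets. -/
def compressibleIdeal (G X : Type*) [Group G] [MulAction G X] [MeasurableSpace X] (i : ℕ) :
    Set (Set X) :=
  {A | ∃ P, A ⊆ P ∧ MeasurableSet P ∧ IsInvariantSet G P ∧ IsStarCompressible G i P}

/-- The statement `p x` holds for all `x` modulo the ideal `J`. -/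
def HoldsModulo {X : Type*} (J : Set (Set X)) (p : X → Prop) : Prop :=
  ∃ Z ∈ J, ∀ x, x ∉ Z → p x

/-- A Boolean `G`-algebra of Borel sets: a family of Borel sets closed under finite unions,
complements and the action. -/
structure IsBooleanGAlgebra (G : Type*) {X : Type*} [Group G] [MulAction G X] [MeasurableSpace X]
    (𝔅 : Set (Set X)) : Prop where
  measurableSet : ∀ A ∈ 𝔅, MeasurableSet A
  union_mem : ∀ A ∈ 𝔅, ∀ B ∈ 𝔅, A ∪ B ∈ 𝔅
  compl_mem : ∀ A ∈ 𝔅, Aᶜ ∈ 𝔅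
  smul_mem : ∀ (g : G), ∀ A ∈ 𝔅, g • A ∈ 𝔅

/-- `μ` restricts to a `G`-invariant finitely additive probability measure on `𝔅`
(the values of `μ` outside `𝔅` are irrelevant). -/
structure IsInvariantFinAddProb (G : Type*) {X : Type*} [Group G] [MulAction G X]
    (𝔅 : Set (Set X)) (μ : Set X → ℝ) : Prop where
  nonneg : ∀ A ∈ 𝔅, 0 ≤ μ A
  univ : μ Set.univ = 1
  union : ∀ A ∈ 𝔅, ∀ B ∈ 𝔅, Disjoint A B → μ (A ∪ B) = μ A + μ B
  smul : ∀ (g : G), ∀ A ∈ 𝔅, μ (g • A) = μ A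

end CompressibleAction

/-! The function m(A, x) measures the relative size of A on the orbit of x: it is the infimum of the
fractions p / q such that q copies of A fit into p copies of the space over that orbit. "Fits" is
decided by one fixed greedy matching on X × ℕ, run along a countable list of moves. The greedy rule
makes `density` Borel, monotone and normalised at every point, and natural under equivariant maps
(`density_preimage`).

The remaining properties rest on comparability over orbits: if the greedy matching leaves one source
point unmatched, it has used up every target point of that orbit
(`emb_of_subset_compl_fullyMatched`). Hence a failure of invariance, additivity or positivity is
confined to countably many invariant sets. Each of these either carries an embedding of too many
copies into too few, or a self-embedding missing part of every orbit, or two disjoint copies of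
itself. The cancellation arguments `isNull_of_forall_emb` and `isNull_of_proper_self_emb` turn the
first two cases into the third, which gives a compression. Such null sets are closed under countable
unions.

The number of generating sets is bounded by carrying this out once, in the universal space of
itineraries with respect to two sets (`exists_exceptional_set`). The pullback of a null set there is
compressed using only A, B and the image of the compression, that is, three sets
(`preimage_itinerary_mem_compressibleIdeal`). For the second claim, the exceptional sets of all
pairs from the algebra lie in that of a single glued pair (`iUnion_preimage_itinerary_subset`), so
some point of A avoids them all, and the density at this point is the required measure. -/

namespace CompressibleAction

open Set

/-- A countable measurable cover admits a measurable choice of an index. -/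
theorem exists_measurable_index {Z : Type*} [MeasurableSpace Z] (p : ℕ → Set Z)
    (hp : ∀ n, MeasurableSet (p n)) :
    ∃ N : Z → ℕ, Measurable N ∧ ∀ z ∈ ⋃ n, p n, z ∈ p (N z) := by
  classical
  have hex : ∀ z, ∃ n, z ∈ p n ∨ z ∉ ⋃ n, p n := fun z => by
    by_cases h : z ∈ ⋃ n, p n
    · obtain ⟨n, hn⟩ := mem_iUnion.1 h
      exact ⟨n, Or.inl hn⟩
    · exact ⟨0, Or.inr h⟩
  refine ⟨fun z => Nat.find (hex z), measurable_find _ fun k => ?_, fun z hz => ?_⟩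
  · exact (hp k).union (MeasurableSet.iUnion hp).compl
  · exact (Nat.find_spec (hex z)).resolve_right (not_not.2 hz)

/-! ### Greedy matchings along a sequence of permutations -/

section Greedy

variable {Z : Type*}

/-- The greedy matching of `A` into `B` along the permutations `e n`: at stage `n` the points
`z ∈ A` and `e n z ∈ B` are matched if neither has been matched before. The two components are
the parts of `A` and of `B` matched before stage `n`. -/
def greedy (e : ℕ → Equiv.Perm Z) (A B : Set Z) : ℕ → Set Z × Set Z
  | 0 => (∅, ∅)
  | n + 1 =>
    ((greedy e A B n).1 ∪ {z | z ∈ A ∧ z ∉ (greedy e A B n).1 ∧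
        e n z ∈ B ∧ e n z ∉ (greedy e A B n).2},
      (greedy e A B n).2 ∪ {w | w ∈ B ∧ w ∉ (greedy e A B n).2 ∧
        (e n).symm w ∈ A ∧ (e n).symm w ∉ (greedy e A B n).1})

/-- The part of `A` that is matched by the greedy matching of `A` into `B`. -/
def matchedDom (e : ℕ → Equiv.Perm Z) (A B : Set Z) : Set Z := ⋃ n, (greedy e A B n).1

/-- The part of `B` that is matched by the greedy matching of `A` into `B`. -/
def matchedRan (e : ℕ → Equiv.Perm Z) (A B : Set Z) : Set Z := ⋃ n, (greedy e A B n).2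

/-- The points of `A` that are matched at stage `n`. -/
def stage (e : ℕ → Equiv.Perm Z) (A B : Set Z) (n : ℕ) : Set Z :=
  {z | z ∈ A ∧ z ∉ (greedy e A B n).1 ∧ e n z ∈ B ∧ e n z ∉ (greedy e A B n).2}

variable (e : ℕ → Equiv.Perm Z) (A B : Set Z)

/-- The matching rule is symmetric in the two sets, so every fact about matched sources gives one
about matched targets. -/
theorem greedy_symm (n : ℕ) :
    greedy (fun k => (e k).symm) B A n = (greedy e A B n).swap := by
  induction n with
  | zero => rfl
  | succ n ih =>
    simp only [greedy, ih, Prod.swap, Equiv.symm_symm]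

theorem matchedDom_symm : matchedDom (fun k => (e k).symm) B A = matchedRan e A B := by
  simp [matchedDom, matchedRan, greedy_symm]

theorem matchedRan_symm : matchedRan (fun k => (e k).symm) B A = matchedDom e A B := by
  simp [matchedDom, matchedRan, greedy_symm]

theorem greedy_mono : Monotone (greedy e A B) :=
  monotone_nat_of_le_succ fun _ => ⟨subset_union_left, subset_union_left⟩

theorem matchedDom_eq_iUnion_stage : matchedDom e A B = ⋃ n, stage e A B n := by
  have key : ∀ n, (greedy e A B n).1 ⊆ ⋃ n, stage e A B n := by
    intro n
    induction n with
    | zero => exact empty_subset _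
    | succ n ih => exact union_subset ih (subset_iUnion (stage e A B) n)
  refine (iUnion_subset key).antisymm (iUnion_subset fun n => ?_)
  exact Subset.trans (subset_union_right) (subset_iUnion (fun n => (greedy e A B n).1) (n + 1))

theorem matchedDom_subset : matchedDom e A B ⊆ A := by
  rw [matchedDom_eq_iUnion_stage]
  exact iUnion_subset fun n z hz => hz.1

theorem matchedRan_subset : matchedRan e A B ⊆ B := by
  rw [← matchedDom_symm]
  exact matchedDom_subset _ _ _

theorem apply_mem_greedy_of_mem_stage {n : ℕ} {z : Z} (hz : z ∈ stage e A B n) :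
    e n z ∈ (greedy e A B (n + 1)).2 :=
  Or.inr ⟨hz.2.2.1, hz.2.2.2, by simpa using hz.1, by simpa using hz.2.1⟩

theorem eq_of_mem_stage {n m : ℕ} {z w : Z} (hz : z ∈ stage e A B n) (hw : w ∈ stage e A B m)
    (h : e n z = e m w) : z = w := by
  rcases lt_trichotomy n m with hnm | rfl | hnm
  · exact absurd ((greedy_mono e A B hnm).2 (apply_mem_greedy_of_mem_stage e A B hz))
      (h ▸ hw.2.2.2)
  · exact (e n).injective h
  · exact absurd ((greedy_mono e A B hnm).2 (apply_mem_greedy_of_mem_stage e A B hw))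
      (h ▸ hz.2.2.2)

/-- The greedy matching leaves no pair of points `z ∈ A`, `e n z ∈ B` unmatched. -/
theorem mem_matchedDom_or_mem_matchedRan {n : ℕ} {z : Z} (hz : z ∈ A) (hw : e n z ∈ B) :
    z ∈ matchedDom e A B ∨ e n z ∈ matchedRan e A B := by
  by_cases h : z ∈ (greedy e A B n).1
  · exact Or.inl (mem_iUnion.2 ⟨n, h⟩)
  by_cases h' : e n z ∈ (greedy e A B n).2
  · exact Or.inr (mem_iUnion.2 ⟨n, h'⟩)
  · exact Or.inl (mem_iUnion.2 ⟨n + 1, Or.inr ⟨hz, h, hw, h'⟩⟩)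

variable {A} in
/-- Shrinking the set to be matched preserves the matched points that remain. -/
theorem matchedDom_anti_left {A' : Set Z} (h : A ⊆ A') :
    matchedDom e A' B ∩ A ⊆ matchedDom e A B := by
  -- The two inclusions need each other: fewer competing sources use up fewer targets, and more free
  -- targets leave the remaining sources at least as well matched.
  have key : ∀ n, (greedy e A' B n).1 ∩ A ⊆ (greedy e A B n).1 ∧
      (greedy e A B n).2 ⊆ (greedy e A' B n).2 := by
    intro n
    induction n with
    | zero => simp [greedy]
    | succ n ih =>
      refine ⟨?_, ?_⟩
      · rintro z ⟨hz | hz, hzA⟩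
        · exact Or.inl (ih.1 ⟨hz, hzA⟩)
        · by_cases hz' : z ∈ (greedy e A B n).1
          · exact Or.inl hz'
          · exact Or.inr ⟨hzA, hz', hz.2.2.1, fun h' => hz.2.2.2 (ih.2 h')⟩
      · rintro w (hw | hw)
        · exact Or.inl (ih.2 hw)
        · by_cases hw' : w ∈ (greedy e A' B n).2
          · exact Or.inl hw'
          · exact Or.inr ⟨hw.1, hw', h hw.2.2.1, fun h' => hw.2.2.2 (ih.1 ⟨h', hw.2.2.1⟩)⟩
  rintro z ⟨hz, hzA⟩
  obtain ⟨n, hn⟩ := mem_iUnion.1 hz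
  exact mem_iUnion.2 ⟨n, (key n).1 ⟨hn, hzA⟩⟩

/-- If the first permutation is the identity, `A ∩ B` is matched to itself, so that nothing else
is matched when `B ⊆ A`. -/
theorem matchedDom_subset_of_subset (he : e 0 = Equiv.refl Z) (h : B ⊆ A) :
    matchedDom e A B ⊆ B := by
  -- Stage 0 already exhausts all targets, so later stages add nothing.
  have key : ∀ n, B ⊆ (greedy e A B (n + 1)).2 ∧ (greedy e A B (n + 1)).1 ⊆ B := by
    intro n
    induction n with
    | zero =>
      refine ⟨fun z hz => Or.inr ?_, ?_⟩
      · simpa [greedy, he] using And.intro hz (h hz)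
      · rintro z (hz | hz)
        · exact hz.elim
        · simpa [he] using hz.2.2.1
    | succ n ih =>
      refine ⟨ih.1.trans subset_union_left, ?_⟩
      rintro z (hz | hz)
      · exact ih.2 hz
      · exact absurd (ih.1 hz.2.2.1) hz.2.2.2
  refine iUnion_subset fun n => ?_
  exact Subset.trans (greedy_mono e A B n.le_succ).1 (key n).2

theorem matchedDom_eq_of_subset (he : e 0 = Equiv.refl Z) (h : A ⊆ B) : matchedDom e A B = A := by
  refine (matchedDom_subset e A B).antisymm fun z hz => mem_iUnion.2 ⟨1, Or.inr ?_⟩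
  simpa [greedy, he] using And.intro hz (h hz)

theorem measurableSet_greedy [MeasurableSpace Z] (he : ∀ n, Measurable (e n))
    (he' : ∀ n, Measurable (e n).symm) (hA : MeasurableSet A) (hB : MeasurableSet B) (n : ℕ) :
    MeasurableSet (greedy e A B n).1 ∧ MeasurableSet (greedy e A B n).2 := by
  induction n with
  | zero => exact ⟨MeasurableSet.empty, MeasurableSet.empty⟩
  | succ n ih =>
    exact ⟨ih.1.union (hA.inter (ih.1.compl.inter ((he n hB).inter (he n ih.2).compl))),
      ih.2.union (hB.inter (ih.2.compl.inter ((he' n hA).inter (he' n ih.1).compl)))⟩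

theorem measurableSet_matchedDom [MeasurableSpace Z] (he : ∀ n, Measurable (e n))
    (he' : ∀ n, Measurable (e n).symm) (hA : MeasurableSet A) (hB : MeasurableSet B) :
    MeasurableSet (matchedDom e A B) :=
  MeasurableSet.iUnion fun n => (measurableSet_greedy e A B he he' hA hB n).1

/-- The greedy matching is given by a measurable injection. -/
theorem exists_matching [MeasurableSpace Z] (he : ∀ n, Measurable (e n))
    (he' : ∀ n, Measurable (e n).symm) (hA : MeasurableSet A) (hB : MeasurableSet B) :
    ∃ θ : Z → Z, Measurable θ ∧ (∀ z, ∃ n, θ z = e n z) ∧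
      MapsTo θ (matchedDom e A B) (matchedRan e A B) ∧ InjOn θ (matchedDom e A B) := by
  have hst : ∀ n, MeasurableSet (stage e A B n) := fun n =>
    have h := measurableSet_greedy e A B he he' hA hB n
    hA.inter (h.1.compl.inter ((he n hB).inter (he n h.2).compl))
  obtain ⟨N, hN, hN'⟩ := exists_measurable_index _ hst
  rw [matchedDom_eq_iUnion_stage]
  refine ⟨fun z => e (N z) z, ?_, fun z => ⟨N z, rfl⟩, fun z hz => ?_, fun z hz w hw h => ?_⟩
  · have : Measurable fun p : ℕ × Z => e p.1 p.2 := measurable_from_prod_countable_right he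
    exact this.comp (hN.prodMk measurable_id)
  · exact mem_iUnion.2 ⟨N z + 1, apply_mem_greedy_of_mem_stage e A B (hN' z hz)⟩
  · exact eq_of_mem_stage e A B (hN' z hz) (hN' w hw) h

/-- The greedy matching is natural. -/
theorem greedy_preimage {Z' : Type*} (e' : ℕ → Equiv.Perm Z') (f : Z' → Z)
    (hf : ∀ n z, f (e' n z) = e n (f z)) (n : ℕ) :
    greedy e' (f ⁻¹' A) (f ⁻¹' B) n =
      (f ⁻¹' (greedy e A B n).1, f ⁻¹' (greedy e A B n).2) := by
  have hf' : ∀ n z, f ((e' n).symm z) = (e n).symm (f z) := fun n z => by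
    rw [Equiv.eq_symm_apply, ← hf, Equiv.apply_symm_apply]
  induction n with
  | zero => rfl
  | succ n ih =>
    simp only [greedy, ih, preimage_union, mem_preimage, hf, hf']
    rfl

theorem matchedDom_preimage {Z' : Type*} (e' : ℕ → Equiv.Perm Z') (f : Z' → Z)
    (hf : ∀ n z, f (e' n z) = e n (f z)) :
    matchedDom e' (f ⁻¹' A) (f ⁻¹' B) = f ⁻¹' matchedDom e A B := by
  simp [matchedDom, greedy_preimage e A B e' f hf]

end Greedy

/-! ### Orbit-preserving embeddings between multiples of sets -/

section Embedding

variable (G : Type*) {X : Type*} [Group G] [MulAction G X]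

/-- `n` disjoint copies of the set `A`. -/
def copies (n : ℕ) (A : Set X) : Set (X × ℕ) := {z | z.1 ∈ A ∧ z.2 < n}

variable {G} in
theorem smul_mem_iff {P : Set X} (hP : ∀ (g : G), ∀ x ∈ P, g • x ∈ P) (g : G) (x : X) :
    g • x ∈ P ↔ x ∈ P :=
  ⟨fun h => by simpa using hP g⁻¹ _ h, hP g x⟩

theorem copies_mono {A B : Set X} (h : A ⊆ B) {m n : ℕ} (hmn : m ≤ n) :
    copies m A ⊆ copies n B :=
  fun _ hz => ⟨h hz.1, hz.2.trans_le hmn⟩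

theorem copies_inter_preimage (n : ℕ) (A P : Set X) :
    copies n A ∩ Prod.fst ⁻¹' P = copies n (A ∩ P) := by
  ext z; simp only [copies, mem_inter_iff, mem_ofPred_eq, mem_preimage]; tauto

variable [MeasurableSpace X]

/-- There is a measurable injection of `S` into `T` that preserves the orbits of the first
coordinates. -/
def Emb (S T : Set (X × ℕ)) : Prop :=
  ∃ θ : X × ℕ → X × ℕ, Measurable θ ∧ MapsTo θ S T ∧ InjOn θ S ∧
    ∀ z ∈ S, ∃ g : G, (θ z).1 = g • z.1

/-- The set `P` is measurable, invariant, and compressed by a measurable injection that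
preserves orbits. -/
structure IsNull (P : Set X) : Prop where
  measurableSet : MeasurableSet P
  smul_mem : ∀ (g : G), ∀ x ∈ P, g • x ∈ P
  compress : ∃ θ : X → X, Measurable θ ∧ InjOn θ P ∧ (∀ x ∈ P, ∃ g : G, θ x = g • x) ∧
    ∀ x ∈ P, ∃ g : G, ∀ y ∈ P, θ y ≠ g • x

variable {G}

theorem measurableSet_copies {A : Set X} (hA : MeasurableSet A) (n : ℕ) :
    MeasurableSet (copies n A) :=
  (measurable_fst hA).inter (measurable_snd (measurableSet_Iio (a := n)))

theorem Emb.of_subset {S T : Set (X × ℕ)} (h : S ⊆ T) : Emb G S T :=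
  ⟨id, measurable_id, h, injOn_id _, fun _ _ => ⟨1, (one_smul _ _).symm⟩⟩

theorem Emb.trans {S T U : Set (X × ℕ)} (h : Emb G S T) (h' : Emb G T U) : Emb G S U := by
  obtain ⟨θ, hm, hmap, hinj, ho⟩ := h
  obtain ⟨θ', hm', hmap', hinj', ho'⟩ := h'
  refine ⟨θ' ∘ θ, hm'.comp hm, hmap'.comp hmap, hinj'.comp hinj hmap, fun z hz => ?_⟩
  obtain ⟨g, hg⟩ := ho z hz
  obtain ⟨g', hg'⟩ := ho' _ (hmap hz)
  exact ⟨g' * g, by rw [Function.comp_apply, hg', hg, mul_smul]⟩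

theorem Emb.mono {S S' T T' : Set (X × ℕ)} (h : Emb G S T) (hS : S' ⊆ S) (hT : T ⊆ T') :
    Emb G S' T' :=
  ((Emb.of_subset hS).trans h).trans (Emb.of_subset hT)

/-- Embeddings restrict to invariant sets. -/
theorem Emb.restrict {S T : Set (X × ℕ)} (h : Emb G S T) {P : Set X}
    (hP : ∀ (g : G), ∀ x ∈ P, g • x ∈ P) :
    Emb G (S ∩ Prod.fst ⁻¹' P) (T ∩ Prod.fst ⁻¹' P) := by
  obtain ⟨θ, hm, hmap, hinj, ho⟩ := h
  refine ⟨θ, hm, fun z hz => ⟨hmap hz.1, ?_⟩, hinj.mono inter_subset_left,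
    fun z hz => ho z hz.1⟩
  obtain ⟨g, hg⟩ := ho z hz.1
  exact mem_preimage.2 (hg ▸ hP g _ hz.2)

/-- Embeddings on an invariant set and on its complement can be glued. -/
theorem Emb.glue {S T : Set (X × ℕ)} {P : Set X} (hPm : MeasurableSet P)
    (hP : ∀ (g : G), ∀ x ∈ P, g • x ∈ P)
    (h : Emb G (S ∩ Prod.fst ⁻¹' P) T) (h' : Emb G (S ∩ Prod.fst ⁻¹' Pᶜ) T) : Emb G S T := by
  classical
  obtain ⟨θ, hm, hmap, hinj, ho⟩ := h
  obtain ⟨θ', hm', hmap', hinj', ho'⟩ := h'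
  have e1 : ∀ z, z.1 ∈ P → (Prod.fst ⁻¹' P).piecewise θ θ' z = θ z := fun z hz =>
    piecewise_eq_of_mem _ _ _ hz
  have e2 : ∀ z, z.1 ∉ P → (Prod.fst ⁻¹' P).piecewise θ θ' z = θ' z := fun z hz =>
    piecewise_eq_of_notMem _ _ _ hz
  have hfst : ∀ z ∈ S, ((Prod.fst ⁻¹' P).piecewise θ θ' z).1 ∈ P ↔ z.1 ∈ P := by
    intro z hz
    by_cases hzP : z.1 ∈ P
    · obtain ⟨g, hg⟩ := ho z ⟨hz, hzP⟩
      rw [e1 z hzP, hg, smul_mem_iff hP]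
    · obtain ⟨g, hg⟩ := ho' z ⟨hz, hzP⟩
      rw [e2 z hzP, hg, smul_mem_iff hP]
  refine ⟨(Prod.fst ⁻¹' P).piecewise θ θ', hm.piecewise (measurable_fst hPm) hm',
    fun z hz => ?_, fun z hz w hw hzw => ?_, fun z hz => ?_⟩
  · by_cases hzP : z.1 ∈ P
    · rw [e1 z hzP]; exact hmap ⟨hz, hzP⟩
    · rw [e2 z hzP]; exact hmap' ⟨hz, hzP⟩
  · have hiff : z.1 ∈ P ↔ w.1 ∈ P := by rw [← hfst z hz, ← hfst w hw, hzw]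
    by_cases hzP : z.1 ∈ P
    · rw [e1 z hzP, e1 w (hiff.1 hzP)] at hzw
      exact hinj ⟨hz, hzP⟩ ⟨hw, hiff.1 hzP⟩ hzw
    · have hwP := fun h => hzP (hiff.2 h)
      rw [e2 z hzP, e2 w hwP] at hzw
      exact hinj' ⟨hz, hzP⟩ ⟨hw, hwP⟩ hzw
  · by_cases hzP : z.1 ∈ P
    · rw [e1 z hzP]; exact ho z ⟨hz, hzP⟩
    · rw [e2 z hzP]; exact ho' z ⟨hz, hzP⟩

/-- Cut the levels into k blocks of length q and apply the embedding within each: the remainder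
modulo q is the level in the block, the quotient shifts the image by multiples of p. -/
theorem Emb.copies_mul {A B : Set X} {q p : ℕ} (h : Emb G (copies q A) (copies p B)) (k : ℕ) :
    Emb G (copies (q * k) A) (copies (p * k) B) := by
  obtain ⟨θ, hm, hmap, hinj, ho⟩ := h
  have hmem : ∀ z ∈ copies (q * k) A, (z.1, z.2 % q) ∈ copies q A := fun z hz =>
    ⟨hz.1, Nat.mod_lt _ (Nat.pos_of_ne_zero fun h0 => by simp [copies, h0] at hz)⟩
  have hred : Measurable fun z : X × ℕ => θ (z.1, z.2 % q) :=
    hm.comp (measurable_fst.prodMk ((Measurable.of_discrete (f := (· % q))).comp measurable_snd))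
  refine ⟨fun z => ((θ (z.1, z.2 % q)).1, (θ (z.1, z.2 % q)).2 + p * (z.2 / q)), ?_,
    fun z hz => ⟨(hmap (hmem z hz)).1, ?_⟩, fun z hz w hw hzw => ?_,
    fun z hz => ho _ (hmem z hz)⟩
  · exact hred.fst.prodMk (hred.snd.add ((Measurable.of_discrete (f := fun i => p * (i / q))).comp
      measurable_snd))
  · have h1 := (hmap (hmem z hz)).2
    have h2 : z.2 / q < k := Nat.div_lt_of_lt_mul hz.2
    calc (θ (z.1, z.2 % q)).2 + p * (z.2 / q) < p + p * (z.2 / q) := by omega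
      _ = p * (z.2 / q + 1) := by ring
      _ ≤ p * k := Nat.mul_le_mul_left _ h2
  · have hz1 := (hmap (hmem z hz)).2
    have hw1 := (hmap (hmem w hw)).2
    have hfst : (θ (z.1, z.2 % q)).1 = (θ (w.1, w.2 % q)).1 :=
      (Prod.ext_iff.1 hzw).1
    have hsnd : (θ (z.1, z.2 % q)).2 + p * (z.2 / q) = (θ (w.1, w.2 % q)).2 + p * (w.2 / q) :=
      (Prod.ext_iff.1 hzw).2
    have hdiv := congrArg (· / p) hsnd
    have hmod := congrArg (· % p) hsnd
    simp only [Nat.add_mul_mod_self_left, Nat.mod_eq_of_lt hz1, Nat.mod_eq_of_lt hw1] at hmod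
    have hp : 0 < p := by omega
    simp only [Nat.add_mul_div_left _ _ hp, Nat.div_eq_of_lt hz1, Nat.div_eq_of_lt hw1,
      zero_add] at hdiv
    have := hinj (hmem z hz) (hmem w hw) (Prod.ext hfst hmod)
    simp only [Prod.mk.injEq] at this
    refine Prod.ext this.1 ?_
    rw [← Nat.mod_add_div z.2 q, ← Nat.mod_add_div w.2 q, this.2, hdiv]

/-- Points outside A are sent to levels shifted by p, above the image of A. Points in both sets
follow the first embedding, so disjointness is not needed. -/
theorem Emb.copies_union {A B C : Set X} {q p p' : ℕ} (hA : MeasurableSet A)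
    (h : Emb G (copies q A) (copies p C)) (h' : Emb G (copies q B) (copies p' C)) :
    Emb G (copies q (A ∪ B)) (copies (p + p') C) := by
  classical
  obtain ⟨θ, hm, hmap, hinj, ho⟩ := h
  obtain ⟨θ', hm', hmap', hinj', ho'⟩ := h'
  set η : X × ℕ → X × ℕ := (Prod.fst ⁻¹' A).piecewise θ
    (fun z => ((θ' z).1, (θ' z).2 + p)) with hη
  have e1 : ∀ z ∈ copies q (A ∪ B), z.1 ∈ A → z ∈ copies q A ∧ η z = θ z := fun z hz hzA =>
    ⟨⟨hzA, hz.2⟩, piecewise_eq_of_mem _ _ _ hzA⟩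
  have e2 : ∀ z ∈ copies q (A ∪ B), z.1 ∉ A → z ∈ copies q B ∧
      η z = ((θ' z).1, (θ' z).2 + p) := fun z hz hzA =>
    ⟨⟨hz.1.resolve_left hzA, hz.2⟩, piecewise_eq_of_notMem _ _ _ hzA⟩
  refine ⟨η, hm.piecewise (measurable_fst hA) (hm'.fst.prodMk (hm'.snd.add_const p)),
    fun z hz => ?_, fun z hz w hw hzw => ?_, fun z hz => ?_⟩
  · by_cases hzA : z.1 ∈ A
    · obtain ⟨h1, h2⟩ := e1 z hz hzA
      rw [h2]
      exact ⟨(hmap h1).1, (hmap h1).2.trans_le (Nat.le_add_right _ _)⟩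
    · obtain ⟨h1, h2⟩ := e2 z hz hzA
      rw [h2]
      exact ⟨(hmap' h1).1, by have := (hmap' h1).2; simp only; omega⟩
  · by_cases hzA : z.1 ∈ A <;> by_cases hwA : w.1 ∈ A
    · obtain ⟨h1, h2⟩ := e1 z hz hzA
      obtain ⟨h3, h4⟩ := e1 w hw hwA
      exact hinj h1 h3 (by rw [← h2, hzw, h4])
    · obtain ⟨h1, h2⟩ := e1 z hz hzA
      obtain ⟨h3, h4⟩ := e2 w hw hwA
      have := congrArg Prod.snd (h2.symm.trans (hzw.trans h4))
      have := (hmap h1).2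
      simp only at *
      omega
    · obtain ⟨h1, h2⟩ := e2 z hz hzA
      obtain ⟨h3, h4⟩ := e1 w hw hwA
      have := congrArg Prod.snd (h2.symm.trans (hzw.trans h4))
      have := (hmap h3).2
      simp only at *
      omega
    · obtain ⟨h1, h2⟩ := e2 z hz hzA
      obtain ⟨h3, h4⟩ := e2 w hw hwA
      have := h2.symm.trans (hzw.trans h4)
      simp only [Prod.mk.injEq, add_left_inj] at this
      exact hinj' h1 h3 (Prod.ext this.1 this.2)
  · by_cases hzA : z.1 ∈ A
    · obtain ⟨h1, h2⟩ := e1 z hz hzA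
      rw [h2]; exact ho z h1
    · obtain ⟨h1, h2⟩ := e2 z hz hzA
      rw [h2]; exact ho' z h1

theorem Emb.copies_add {A B C : Set X} {q p p' : ℕ} (hAB : Disjoint A B)
    (h : Emb G (copies p C) (copies q A)) (h' : Emb G (copies p' C) (copies q B)) :
    Emb G (copies (p + p') C) (copies q (A ∪ B)) := by
  classical
  obtain ⟨θ, hm, hmap, hinj, ho⟩ := h
  obtain ⟨θ', hm', hmap', hinj', ho'⟩ := h'
  set η : X × ℕ → X × ℕ := (Prod.snd ⁻¹' Iio p).piecewise θ
    (fun z => θ' (z.1, z.2 - p)) with hη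
  have e1 : ∀ z ∈ copies (p + p') C, z.2 < p → z ∈ copies p C ∧ η z = θ z := fun z hz hzA =>
    ⟨⟨hz.1, hzA⟩, piecewise_eq_of_mem _ _ _ hzA⟩
  have e2 : ∀ z ∈ copies (p + p') C, ¬ z.2 < p → (z.1, z.2 - p) ∈ copies p' C ∧
      η z = θ' (z.1, z.2 - p) := fun z hz hzA =>
    ⟨⟨hz.1, by have := hz.2; simp only; omega⟩, piecewise_eq_of_notMem _ _ _ hzA⟩
  have hne : ∀ z w, z ∈ copies p C → w ∈ copies p' C → θ z ≠ θ' w := fun z w hz hw h =>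
    hAB.le_bot ⟨(hmap hz).1, h ▸ (hmap' hw).1⟩
  refine ⟨η, hm.piecewise (measurable_snd measurableSet_Iio) (hm'.comp
    (measurable_fst.prodMk ((Measurable.of_discrete (f := (· - p))).comp measurable_snd))),
    fun z hz => ?_, fun z hz w hw hzw => ?_, fun z hz => ?_⟩
  · by_cases hzA : z.2 < p
    · obtain ⟨h1, h2⟩ := e1 z hz hzA
      rw [h2]
      exact ⟨Or.inl (hmap h1).1, (hmap h1).2⟩
    · obtain ⟨h1, h2⟩ := e2 z hz hzA
      rw [h2]
      exact ⟨Or.inr (hmap' h1).1, (hmap' h1).2⟩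
  · by_cases hzA : z.2 < p <;> by_cases hwA : w.2 < p
    · obtain ⟨h1, h2⟩ := e1 z hz hzA
      obtain ⟨h3, h4⟩ := e1 w hw hwA
      exact hinj h1 h3 (by rw [← h2, hzw, h4])
    · obtain ⟨h1, h2⟩ := e1 z hz hzA
      obtain ⟨h3, h4⟩ := e2 w hw hwA
      exact absurd (h2.symm.trans (hzw.trans h4)) (hne _ _ h1 h3)
    · obtain ⟨h1, h2⟩ := e2 z hz hzA
      obtain ⟨h3, h4⟩ := e1 w hw hwA
      exact absurd (h4.symm.trans (hzw.symm.trans h2)) (hne _ _ h3 h1)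
    · obtain ⟨h1, h2⟩ := e2 z hz hzA
      obtain ⟨h3, h4⟩ := e2 w hw hwA
      have := hinj' h1 h3 (h2.symm.trans (hzw.trans h4))
      simp only [Prod.mk.injEq] at this
      exact Prod.ext this.1 (by omega)
  · by_cases hzA : z.2 < p
    · obtain ⟨h1, h2⟩ := e1 z hz hzA
      rw [h2]; exact ho z h1
    · obtain ⟨h1, h2⟩ := e2 z hz hzA
      rw [h2]; exact ho' _ h1

end Embedding

/-! ### The σ-ideal of compressible invariant sets -/

section Null

variable {G X : Type*} [Group G] [MulAction G X] [MeasurableSpace X]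

theorem IsNull.mono {P Q : Set X} (h : IsNull G P) (hQP : Q ⊆ P) (hQ : MeasurableSet Q)
    (hinv : ∀ (g : G), ∀ x ∈ Q, g • x ∈ Q) : IsNull G Q := by
  obtain ⟨-, -, θ, hm, hinj, ho, hc⟩ := h
  refine ⟨hQ, hinv, θ, hm, hinj.mono hQP, fun x hx => ho x (hQP hx), fun x hx => ?_⟩
  obtain ⟨g, hg⟩ := hc x (hQP hx)
  exact ⟨g, fun y hy => hg y (hQP hy)⟩

/-- Disjointed pieces of invariant sets are again invariant, so each compression stays inside its
own piece and the maps can be glued without losing injectivity. -/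
theorem IsNull.iUnion {P : ℕ → Set X} (h : ∀ n, IsNull G (P n)) : IsNull G (⋃ n, P n) := by
  have hinv : ∀ (g : G), ∀ x ∈ ⋃ n, P n, g • x ∈ ⋃ n, P n := fun g x hx => by
    obtain ⟨n, hn⟩ := mem_iUnion.1 hx
    exact mem_iUnion.2 ⟨n, (h n).smul_mem g x hn⟩
  have hdm : ∀ n, MeasurableSet (disjointed P n) := fun n =>
    MeasurableSet.disjointed (fun i => (h i).measurableSet) n
  have hdinv : ∀ n (g : G) x, x ∈ disjointed P n → g • x ∈ disjointed P n := by
    intro n g x hx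
    rw [disjointed_eq_inter_compl] at hx ⊢
    refine ⟨(h n).smul_mem g x hx.1, mem_iInter₂.2 fun j hj hgx => ?_⟩
    exact mem_iInter₂.1 hx.2 j hj ((smul_mem_iff (h j).smul_mem g x).1 hgx)
  have hnull : ∀ n, IsNull G (disjointed P n) := fun n =>
    (h n).mono (disjointed_subset P n) (hdm n) (hdinv n)
  have hdisj : ∀ {i j x}, x ∈ disjointed P i → x ∈ disjointed P j → i = j := by
    intro i j x hi hj
    by_contra hij
    exact (disjoint_disjointed P hij).le_bot ⟨hi, hj⟩
  choose θ hm hinj ho hc using fun n => (hnull n).compress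
  obtain ⟨η, hηm, hη⟩ := exists_measurable_piecewise (disjointed P) hdm θ hm
    (fun i j hij x hx => absurd (hdisj hx.1 hx.2) hij)
  have hmem : ∀ n, ∀ x ∈ disjointed P n, η x ∈ disjointed P n := fun n x hx => by
    obtain ⟨g, hg⟩ := ho n x hx
    rw [hη n hx, hg]
    exact hdinv n g x hx
  refine ⟨MeasurableSet.iUnion fun n => (h n).measurableSet, hinv, η, hηm, ?_, ?_, ?_⟩ <;>
    rw [← iUnion_disjointed]
  · intro x hx y hy hxy
    obtain ⟨n, hn⟩ := mem_iUnion.1 hx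
    obtain ⟨k, hk⟩ := mem_iUnion.1 hy
    obtain rfl : n = k := hdisj (hmem n x hn) (hxy ▸ hmem k y hk)
    exact hinj n hn hk (by rw [← hη n hn, ← hη n hk, hxy])
  · intro x hx
    obtain ⟨n, hn⟩ := mem_iUnion.1 hx
    rw [hη n hn]
    exact ho n x hn
  · intro x hx
    obtain ⟨n, hn⟩ := mem_iUnion.1 hx
    obtain ⟨g, hg⟩ := hc n x hn
    refine ⟨g, fun y hy hyx => ?_⟩
    obtain ⟨k, hk⟩ := mem_iUnion.1 hy
    obtain rfl : n = k := hdisj (hdinv n g x hn) (hyx ▸ hmem k y hk)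
    exact hg y hk (by rw [← hη n hk, hyx])

theorem IsNull.iUnion_countable {ι : Type*} [Countable ι] [Nonempty ι] {P : ι → Set X}
    (h : ∀ i, IsNull G (P i)) : IsNull G (⋃ i, P i) := by
  obtain ⟨f, hf⟩ := exists_surjective_nat ι
  rw [← hf.iUnion_comp]
  exact IsNull.iUnion fun n => h (f n)

theorem IsNull.union {P Q : Set X} (hP : IsNull G P) (hQ : IsNull G Q) : IsNull G (P ∪ Q) := by
  rw [union_eq_iUnion]
  exact IsNull.iUnion_countable fun b => by cases b <;> assumption

/-- The first copy supplies the compression; the image of the second copy supplies a missed point in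
every orbit. -/
theorem IsNull.of_emb_two {P : Set X} (hPm : MeasurableSet P)
    (hP : ∀ (g : G), ∀ x ∈ P, g • x ∈ P) (h : Emb G (copies 2 P) (copies 1 P)) :
    IsNull G P := by
  obtain ⟨θ, hm, hmap, hinj, ho⟩ := h
  have h0 : ∀ x ∈ P, (x, 0) ∈ copies 2 P := fun x hx => ⟨hx, two_pos⟩
  have h1 : ∀ x ∈ P, (x, 1) ∈ copies 2 P := fun x hx => ⟨hx, one_lt_two⟩
  have hz : ∀ z ∈ copies 2 P, ∀ w ∈ copies 2 P, (θ z).1 = (θ w).1 → z = w := by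
    intro z hz w hw hzw
    refine hinj hz hw (Prod.ext hzw ?_)
    rw [Nat.lt_one_iff.1 (hmap hz).2, Nat.lt_one_iff.1 (hmap hw).2]
  refine ⟨hPm, hP, fun x => (θ (x, 0)).1, (hm.comp (measurable_id.prodMk measurable_const)).fst,
    fun x hx y hy hxy => congrArg Prod.fst (hz _ (h0 x hx) _ (h0 y hy) hxy),
    fun x hx => ho _ (h0 x hx), fun x hx => ?_⟩
  obtain ⟨g, hg⟩ := ho _ (h1 x hx)
  refine ⟨g, fun y hy hyx => ?_⟩
  have := hz _ (h0 y hy) _ (h1 x hx) (hyx.trans hg.symm)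
  simp at this

end Null

/-! ### The moves on X × ℕ -/

section Moves

variable (G X : Type*) [Group G] [MulAction G X]

/-- A sequence of permutations of `X × ℕ` that connect any two points of which the first
coordinates are in the same orbit. It starts with the identity. -/
noncomputable def move [Countable G] (n : ℕ) : Equiv.Perm (X × ℕ) :=
  let s : G × ℕ × ℕ := n.casesOn (1, 0, 0) (exists_surjective_nat (G × ℕ × ℕ)).choose
  (MulAction.toPerm s.1).prodCongr (Equiv.swap s.2.1 s.2.2)

variable [Countable G]

/-- Trying the identity first is what makes the density of the whole space equal to 1 everywhere,
with no exceptional set. -/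
theorem move_zero : move G X 0 = Equiv.refl _ := by
  ext z <;> simp [move]

variable {X}

theorem exists_move_fst (n : ℕ) (z : X × ℕ) : ∃ g : G, (move G X n z).1 = g • z.1 :=
  ⟨_, rfl⟩

theorem exists_move_eq (g : G) (x : X) (i j : ℕ) : ∃ n, move G X n (x, i) = (g • x, j) := by
  obtain ⟨n, hn⟩ := (exists_surjective_nat (G × ℕ × ℕ)).choose_spec (g, i, j)
  refine ⟨n + 1, ?_⟩
  simp [move, hn]

theorem move_equivariant {Y : Type*} [MulAction G Y] {f : X → Y}
    (hf : ∀ (g : G) x, f (g • x) = g • f x) (n : ℕ) (z : X × ℕ) :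
    Prod.map f id (move G X n z) = move G Y n (Prod.map f id z) :=
  Prod.ext (hf _ _) rfl

variable [MeasurableSpace X] [MeasurableConstSMul G X]

theorem measurable_move (n : ℕ) : Measurable (move G X n) :=
  ((measurable_const_smul _).comp measurable_fst).prodMk
    (Measurable.of_discrete.comp measurable_snd)

theorem measurable_move_symm (n : ℕ) : Measurable (move G X n).symm :=
  ((measurable_const_smul _).comp measurable_fst).prodMk
    (Measurable.of_discrete.comp measurable_snd)

end Moves

/-! ### Comparability over orbits -/

section Comparison

variable (G : Type*) {X : Type*} [Group G] [Countable G] [MulAction G X]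

/-- The orbits over which all points of `S` are matched by the greedy matching of `S` into `T`. -/
def fullyMatched (S T : Set (X × ℕ)) : Set X :=
  {x | ∀ (g : G) (i : ℕ), (g • x, i) ∈ S → (g • x, i) ∈ matchedDom (move G X) S T}

theorem smul_mem_fullyMatched (S T : Set (X × ℕ)) (g : G) (x : X) (hx : x ∈ fullyMatched G S T) :
    g • x ∈ fullyMatched G S T := fun h i => by
  rw [← mul_smul]
  exact hx (h * g) i

variable [MeasurableSpace X] [MeasurableConstSMul G X] {S T : Set (X × ℕ)}

theorem measurableSet_matchedDom_move (hS : MeasurableSet S) (hT : MeasurableSet T) :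
    MeasurableSet (matchedDom (move G X) S T) :=
  measurableSet_matchedDom _ _ _ (measurable_move G) (measurable_move_symm G) hS hT

theorem measurableSet_matchedRan_move (hS : MeasurableSet S) (hT : MeasurableSet T) :
    MeasurableSet (matchedRan (move G X) S T) := by
  rw [← matchedDom_symm]
  exact measurableSet_matchedDom _ _ _ (measurable_move_symm G) (measurable_move G) hT hS

theorem measurableSet_fullyMatched (hS : MeasurableSet S) (hT : MeasurableSet T) :
    MeasurableSet (fullyMatched G S T) := by
  have : fullyMatched G S T =
      ⋂ (g : G) (i : ℕ), (fun x => (g • x, i)) ⁻¹' (Sᶜ ∪ matchedDom (move G X) S T) := by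
    ext x
    simp [fullyMatched, imp_iff_not_or]
  rw [this]
  exact MeasurableSet.iInter fun g => MeasurableSet.iInter fun i =>
    ((measurable_const_smul g).prodMk measurable_const)
      (hS.compl.union (measurableSet_matchedDom_move G hS hT))

theorem emb_matchedDom (hS : MeasurableSet S) (hT : MeasurableSet T) :
    Emb G (matchedDom (move G X) S T) (matchedRan (move G X) S T) := by
  obtain ⟨θ, hm, ho, hmap, hinj⟩ := exists_matching (move G X) S T (measurable_move G)
    (measurable_move_symm G) hS hT
  refine ⟨θ, hm, hmap, hinj, fun z _ => ?_⟩
  obtain ⟨n, hn⟩ := ho z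
  rw [hn]
  exact exists_move_fst G n z

theorem emb_matchedRan (hS : MeasurableSet S) (hT : MeasurableSet T) :
    Emb G (matchedRan (move G X) S T) (matchedDom (move G X) S T) := by
  rw [← matchedDom_symm (move G X) S T, ← matchedRan_symm (move G X) S T]
  obtain ⟨θ, hm, ho, hmap, hinj⟩ := exists_matching (fun n => (move G X n).symm) T S
    (measurable_move_symm G) (measurable_move G) hT hS
  exact ⟨θ, hm, hmap, hinj, fun z _ => by obtain ⟨n, hn⟩ := ho z; exact hn ▸ ⟨_, rfl⟩⟩

theorem emb_of_subset_fullyMatched (hS : MeasurableSet S) (hT : MeasurableSet T) {P : Set X}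
    (hP : ∀ (g : G), ∀ x ∈ P, g • x ∈ P) (h : P ⊆ fullyMatched G S T) :
    Emb G (S ∩ Prod.fst ⁻¹' P) (T ∩ Prod.fst ⁻¹' P) := by
  refine ((emb_matchedDom G hS hT).restrict hP).mono (fun z hz => ⟨?_, hz.2⟩)
    (inter_subset_inter_left _ (matchedRan_subset _ _ _))
  simpa using h hz.2 1 z.2 (by simpa using hz.1)

theorem emb_of_subset_compl_fullyMatched (hS : MeasurableSet S) (hT : MeasurableSet T)
    {P : Set X} (hP : ∀ (g : G), ∀ x ∈ P, g • x ∈ P) (h : P ⊆ (fullyMatched G S T)ᶜ) :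
    Emb G (T ∩ Prod.fst ⁻¹' P) (matchedDom (move G X) S T ∩ Prod.fst ⁻¹' P) := by
  refine ((emb_matchedRan G hS hT).restrict hP).mono (fun z hz => ⟨?_, hz.2⟩) subset_rfl
  have := h hz.2
  simp only [fullyMatched, mem_compl_iff, mem_ofPred_eq, not_forall] at this
  obtain ⟨g, i, hgi, hn⟩ := this
  -- Some move carries the unmatched source to the given target; the greedy rule leaves no such pair
  -- unmatched, so the target is taken.
  obtain ⟨n, hn'⟩ := exists_move_eq G g⁻¹ (g • z.1) i z.2
  rw [inv_smul_smul] at hn'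
  have := mem_matchedDom_or_mem_matchedRan (move G X) S T hgi (n := n) (by rw [hn']; exact hz.1)
  rw [hn'] at this
  exact this.resolve_left hn

/-- Comparability of measurable sets. -/
theorem exists_comparison (hS : MeasurableSet S) (hT : MeasurableSet T) :
    ∃ P : Set X, MeasurableSet P ∧ (∀ (g : G), ∀ x ∈ P, g • x ∈ P) ∧
      Emb G (S ∩ Prod.fst ⁻¹' P) (T ∩ Prod.fst ⁻¹' P) ∧
      Emb G (T ∩ Prod.fst ⁻¹' Pᶜ) (S ∩ Prod.fst ⁻¹' Pᶜ) := by
  refine ⟨fullyMatched G S T, measurableSet_fullyMatched G hS hT, smul_mem_fullyMatched G S T,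
    emb_of_subset_fullyMatched G hS hT (smul_mem_fullyMatched G S T) subset_rfl,
    (emb_of_subset_compl_fullyMatched G hS hT (P := (fullyMatched G S T)ᶜ)
      (fun g x hx h => hx ((smul_mem_iff (smul_mem_fullyMatched G S T) g x).1 h)) subset_rfl).mono subset_rfl
      (inter_subset_inter_left _ (matchedDom_subset _ _ _))⟩

end Comparison

/-! ### Cancellation: from paradoxical multiples to compressions -/

section Divisibility

theorem exists_large_fiber {N L : ℕ} (hN : 0 < N) (f : Fin (N * L) → ℕ) (hf : ∀ k, f k < N) :
    ∃ j < N, ∃ ι : ℕ → ℕ, InjOn ι (Iio L) ∧ ∀ i < L, ∃ h : ι i < N * L, f ⟨ι i, h⟩ = j := by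
  obtain ⟨j, hj, hL⟩ := Finset.exists_le_card_fiber_of_mul_le_card_of_maps_to
    (s := Finset.univ) (t := Finset.range N) (f := f) (n := L) (fun k _ => by simpa using hf k)
    ⟨0, by simpa using hN⟩ (by simp)
  set o := Finset.orderEmbOfCardLe _ hL with ho
  refine ⟨j, by simpa using hj, fun i => if h : i < L then o ⟨i, h⟩ else 0, ?_, fun i hi => ?_⟩
  · intro a ha b hb hab
    simp only [mem_Iio] at ha hb
    simpa [ha, hb, Fin.val_inj] using hab
  · have := Finset.orderEmbOfCardLe_mem _ hL ⟨i, hi⟩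
    simp only [hi, dite_true]
    exact ⟨(o ⟨i, hi⟩).2, by simpa using this⟩

variable {G X : Type*} [Group G] [Countable G] [MulAction G X] [MeasurableSpace X]
  [MeasurableConstSMul G X]

/-- Finitely many sets are dominated by a single set that is as small as any of them. -/
theorem exists_emb_copies_biUnion {P : Set X} {L : ℕ} (s : ℕ → Set X)
    (hs : ∀ i, MeasurableSet (s i)) (n : ℕ)
    (h : ∀ i < n, Emb G (copies L (s i)) (copies 1 P)) :
    ∃ Y, MeasurableSet Y ∧ Emb G (copies L Y) (copies 1 P) ∧
      Emb G (copies 1 (⋃ i < n, s i)) (copies n Y) := by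
  induction n with
  | zero =>
    refine ⟨∅, MeasurableSet.empty, Emb.of_subset fun z hz => hz.1.elim,
      Emb.of_subset fun z hz => ?_⟩
    simpa using hz.1
  | succ n ih =>
    obtain ⟨Y, hY, hYP, hYs⟩ := ih fun i hi => h i (hi.trans n.lt_succ_self)
    -- Over each orbit keep the larger of `Y` and `s n`: it dominates both and still has L copies
    -- inside P.
    obtain ⟨Q, hQm, hQ, h1, h2⟩ := exists_comparison G (measurableSet_copies hY 1)
      (measurableSet_copies (hs n) 1)
    have hle : Emb G (copies 1 Y) (copies 1 (s n ∩ Q ∪ Y ∩ Qᶜ)) :=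
      Emb.glue hQm hQ (h1.mono subset_rfl fun z hz => ⟨Or.inl ⟨hz.1.1, hz.2⟩, hz.1.2⟩)
        (Emb.of_subset fun z hz => ⟨Or.inr ⟨hz.1.1, hz.2⟩, hz.1.2⟩)
    have hle' : Emb G (copies 1 (s n)) (copies 1 (s n ∩ Q ∪ Y ∩ Qᶜ)) :=
      Emb.glue hQm hQ (Emb.of_subset fun z hz => ⟨Or.inl ⟨hz.1.1, hz.2⟩, hz.1.2⟩)
        (h2.mono subset_rfl fun z hz => ⟨Or.inr ⟨hz.1.1, hz.2⟩, hz.1.2⟩)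
    refine ⟨s n ∩ Q ∪ Y ∩ Qᶜ, ((hs n).inter hQm).union (hY.inter hQm.compl), ?_, ?_⟩
    · refine Emb.glue hQm hQ ((h n n.lt_succ_self).mono ?_ subset_rfl)
        (hYP.mono ?_ subset_rfl)
      · rintro z ⟨⟨hz | hz, hz'⟩, hzQ⟩
        · exact ⟨hz.1, hz'⟩
        · exact absurd hzQ hz.2
      · rintro z ⟨⟨hz | hz, hz'⟩, hzQ⟩
        · exact absurd hz.2 hzQ
        · exact ⟨hz.1, hz'⟩
    · have hU : (⋃ i < n + 1, s i) = (⋃ i < n, s i) ∪ s n := by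
        rw [biUnion_lt_succ]
      rw [hU]
      refine Emb.copies_union (MeasurableSet.iUnion fun i => MeasurableSet.iUnion fun _ => hs i)
        (hYs.trans ?_) hle'
      simpa using hle.copies_mul n

/-- An invariant set that has arbitrarily many disjoint copies in finitely many copies of itself
is compressible. -/
theorem isNull_of_forall_emb {P : Set X} (hPm : MeasurableSet P)
    (hP : ∀ (g : G), ∀ x ∈ P, g • x ∈ P) (N : ℕ)
    (h : ∀ K, Emb G (copies K P) (copies N P)) : IsNull G P := by
  classical
  rcases Nat.eq_zero_or_pos N with rfl | hN
  · refine IsNull.of_emb_two hPm hP ((h 2).mono subset_rfl fun z hz => ?_)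
    exact absurd hz.2 (Nat.not_lt_zero _)
  -- With this L, the N copies of the dominating set `Y` that cover P can be taken twice and still
  -- fit into a single copy of P.
  set L := N * 2 with hL
  obtain ⟨θ, hm, hmap, hinj, ho⟩ := h (N * L)
  -- By pigeonhole, one of the N target levels receives L of the copies. The choice depends only on
  -- the pattern of levels, a point of a countable discrete space, so it is measurable.
  have hsel : ∀ f : Fin (N * L) → ℕ, ∃ (j : ℕ) (ι : ℕ → ℕ), (∀ k, f k < N) →
      (j < N ∧ InjOn ι (Iio L) ∧ ∀ i < L, ∃ h : ι i < N * L, f ⟨ι i, h⟩ = j) := by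
    intro f
    by_cases hf : ∀ k, f k < N
    · obtain ⟨j, hj, ι, h1, h2⟩ := exists_large_fiber hN f hf
      exact ⟨j, ι, fun _ => ⟨hj, h1, h2⟩⟩
    · exact ⟨0, id, fun h => absurd h hf⟩
  choose J ι hJι using hsel
  let F : X → Fin (N * L) → ℕ := fun x k => (θ (x, k)).2
  have hF : Measurable F := measurable_pi_lambda _ fun k =>
    (hm.comp (measurable_id.prodMk measurable_const)).snd
  have hFN : ∀ x ∈ P, ∀ k, F x k < N := fun x hx k => (hmap (x := (x, (k : ℕ))) ⟨hx, k.2⟩).2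
  let s : ℕ → Set X := fun j => P ∩ {x | J (F x) = j}
  have hs : ∀ j, MeasurableSet (s j) := fun j =>
    hPm.inter (((Measurable.of_discrete (f := J)).comp hF) (measurableSet_singleton j))
  have hemb : ∀ j < N, Emb G (copies L (s j)) (copies 1 P) := by
    intro j _
    have hmem : ∀ z ∈ copies L (s j), (z.1, ι (F z.1) z.2) ∈ copies (N * L) P ∧
        (θ (z.1, ι (F z.1) z.2)).2 = j := by
      rintro ⟨x, i⟩ ⟨⟨hx, hxj⟩, hi⟩
      obtain ⟨h1, h2⟩ := (hJι (F x) (hFN x hx)).2.2 i hi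
      exact ⟨⟨hx, h1⟩, h2.trans hxj⟩
    have hidx : Measurable fun z : X × ℕ => ι (F z.1) z.2 :=
      (Measurable.of_discrete (f := fun p : (Fin (N * L) → ℕ) × ℕ => ι p.1 p.2)).comp
        ((hF.comp measurable_fst).prodMk measurable_snd)
    refine ⟨fun z => ((θ (z.1, ι (F z.1) z.2)).1, 0),
      (hm.comp (measurable_fst.prodMk hidx)).fst.prodMk measurable_const,
      fun z hz => ⟨(hmap (hmem z hz).1).1, one_pos⟩, ?_, fun z hz => ho _ (hmem z hz).1⟩
    intro z hz w hw hzw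
    have := hinj (hmem z hz).1 (hmem w hw).1
      (Prod.ext (Prod.ext_iff.1 hzw).1 ((hmem z hz).2.trans (hmem w hw).2.symm))
    simp only [Prod.mk.injEq] at this
    refine Prod.ext this.1 ((hJι (F z.1) (hFN _ hz.1.1)).2.1 hz.2 hw.2 ?_)
    rw [this.2, this.1]
  obtain ⟨Y, -, hYP, hYs⟩ := exists_emb_copies_biUnion s hs N hemb
  refine IsNull.of_emb_two hPm hP ?_
  have hPY : Emb G (copies 1 P) (copies N Y) := by
    refine hYs.mono (copies_mono (fun x hx => ?_) le_rfl) subset_rfl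
    exact mem_iUnion₂.2 ⟨J (F x), (hJι (F x) (hFN x hx)).1, hx, rfl⟩
  simpa using (hPY.copies_mul 2).trans hYP

/-- If every orbit in `P` meets a subset of `S` missed by an embedding of `S` into itself,
and `S` embeds into finitely many copies of `P`, then `P` is compressible. -/
theorem isNull_of_proper_self_emb {P : Set X} (hPm : MeasurableSet P)
    (hP : ∀ (g : G), ∀ x ∈ P, g • x ∈ P) {S D T : Set (X × ℕ)} {N : ℕ}
    (hD : MeasurableSet D) (hDS : D ⊆ S) (hTS : T ⊆ S \ D) (hST : Emb G S T)
    (hDP : ∀ x ∈ P, ∃ (g : G) (j : ℕ), (g • x, j) ∈ D) (hS : Emb G S (copies N P)) :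
    IsNull G P := by
  refine isNull_of_forall_emb hPm hP N fun K => Emb.trans ?_ hS
  obtain ⟨θ, hm, hmap, hinj, ho⟩ := hST
  have hmapS : MapsTo θ S S := fun z hz => (hTS (hmap hz)).1
  obtain ⟨a, ha⟩ := exists_surjective_nat (G × ℕ)
  have hσm : ∀ n, Measurable fun x : X => ((a n).1 • x, (a n).2) := fun n =>
    (measurable_const_smul (a n).1).prodMk measurable_const
  obtain ⟨ν, hν, hν'⟩ := exists_measurable_index (fun n => (fun x : X => ((a n).1 • x, (a n).2)) ⁻¹' D)
    (fun n => hσm n hD)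
  have hνD : ∀ x ∈ P, ((a (ν x)).1 • x, (a (ν x)).2) ∈ D := fun x hx => by
    refine hν' x ?_
    obtain ⟨g, j, hgj⟩ := hDP x hx
    obtain ⟨n, hn⟩ := ha (g, j)
    exact mem_iUnion.2 ⟨n, by simpa [hn] using hgj⟩
  -- The iterated images of D are pairwise disjoint: cancel common iterates until one side lies in
  -- D, which the image of θ avoids.
  have hiter : ∀ n m : ℕ, ∀ z ∈ D, ∀ w ∈ D, θ^[n] z = θ^[m] w → n = m ∧ z = w := by
    intro n
    induction n with
    | zero =>
      intro m z hz w hw h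
      cases m with
      | zero => exact ⟨rfl, h⟩
      | succ m =>
        rw [Function.iterate_succ_apply', Function.iterate_zero_apply] at h
        exact absurd (h ▸ hz) (hTS (hmap (hmapS.iterate m (hDS hw)))).2
    | succ n ih =>
      intro m z hz w hw h
      cases m with
      | zero =>
        rw [Function.iterate_succ_apply', Function.iterate_zero_apply] at h
        exact absurd (h ▸ hw) (hTS (hmap (hmapS.iterate n (hDS hz)))).2
      | succ m =>
        rw [Function.iterate_succ_apply', Function.iterate_succ_apply'] at h
        have := ih m z hz w hw (hinj (hmapS.iterate n (hDS hz)) (hmapS.iterate m (hDS hw)) h)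
        exact ⟨by rw [this.1], this.2⟩
  have horb : ∀ n, ∀ z ∈ S, ∃ g : G, (θ^[n] z).1 = g • z.1 := by
    intro n z hz
    induction n with
    | zero => exact ⟨1, (one_smul _ _).symm⟩
    | succ n ih =>
      obtain ⟨g, hg⟩ := ih
      obtain ⟨g', hg'⟩ := ho _ (hmapS.iterate n hz)
      exact ⟨g' * g, by rw [Function.iterate_succ_apply', hg', hg, mul_smul]⟩
  -- The number of iterations records both the level and the index of the group element used to
  -- reach D; knowing that index, the original point can be recovered.
  refine ⟨fun z => θ^[Nat.pair z.2 (ν z.1)] ((a (ν z.1)).1 • z.1, (a (ν z.1)).2), ?_,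
    fun z hz => hmapS.iterate _ (hDS (hνD z.1 hz.1)), fun z hz w hw hzw => ?_, fun z hz => ?_⟩
  · have : Measurable fun p : (ℕ × ℕ) × X =>
        θ^[Nat.pair p.1.1 p.1.2] ((a p.1.2).1 • p.2, (a p.1.2).2) :=
      measurable_from_prod_countable_right fun p =>
        (hm.iterate (Nat.pair p.1 p.2)).comp (hσm p.2)
    exact this.comp ((measurable_snd.prodMk (hν.comp measurable_fst)).prodMk measurable_fst)
  · obtain ⟨h1, h2⟩ := hiter _ _ _ (hνD z.1 hz.1) _ (hνD w.1 hw.1) hzw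
    obtain ⟨h3, h4⟩ := Nat.pair_eq_pair.1 h1
    rw [h4] at h2
    exact Prod.ext (smul_left_cancel _ (Prod.ext_iff.1 h2).1) h3
  · obtain ⟨g, hg⟩ := horb (Nat.pair z.2 (ν z.1)) _ (hDS (hνD z.1 hz.1))
    exact ⟨g * (a (ν z.1)).1, by rw [hg, mul_smul]⟩

theorem isNull_of_emb_copies_lt {P : Set X} (hPm : MeasurableSet P)
    (hP : ∀ (g : G), ∀ x ∈ P, g • x ∈ P) {M N : ℕ} (hMN : M < N)
    (h : Emb G (copies N P) (copies M P)) : IsNull G P := by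
  refine isNull_of_proper_self_emb hPm hP (S := copies N P) (D := copies N P \ copies M P)
    (T := copies M P) (N := N) ((measurableSet_copies hPm N).diff (measurableSet_copies hPm M))
    sdiff_subset (fun z hz => ⟨copies_mono subset_rfl hMN.le hz, fun h => h.2 hz⟩) h
    (fun x hx => ⟨1, M, ?_⟩) (Emb.of_subset subset_rfl)
  simp [copies, hx, hMN]

end Divisibility

/-! ### The relation "q copies of A fit into p copies of the space" -/

section Atmost

variable (G : Type*) {X : Type*} [Group G] [Countable G] [MulAction G X]

/-- The points over the orbits of which `q` copies of `A` are matched greedily into `p` copies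
of the space. -/
def atMost (q : ℕ) (A : Set X) (p : ℕ) : Set X :=
  fullyMatched G (copies q A) (copies p univ)

theorem smul_mem_atMost (q : ℕ) (A : Set X) (p : ℕ) (g : G) (x : X) (hx : x ∈ atMost G q A p) :
    g • x ∈ atMost G q A p :=
  smul_mem_fullyMatched G _ _ g x hx

theorem smul_mem_compl_atMost (q : ℕ) (A : Set X) (p : ℕ) (g : G) (x : X)
    (hx : x ∈ (atMost G q A p)ᶜ) : g • x ∈ (atMost G q A p)ᶜ :=
  fun h => hx ((smul_mem_iff (smul_mem_atMost G q A p) g x).1 h)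

variable [MeasurableSpace X] [MeasurableConstSMul G X]

theorem measurableSet_atMost (q : ℕ) {A : Set X} (hA : MeasurableSet A) (p : ℕ) :
    MeasurableSet (atMost G q A p) :=
  measurableSet_fullyMatched G (measurableSet_copies hA q)
    (measurableSet_copies MeasurableSet.univ p)

variable {G} {q p : ℕ} {A P : Set X}

theorem emb_of_subset_atMost (hA : MeasurableSet A) (hP : ∀ (g : G), ∀ x ∈ P, g • x ∈ P)
    (h : P ⊆ atMost G q A p) : Emb G (copies q (A ∩ P)) (copies p P) := by
  have := emb_of_subset_fullyMatched G (measurableSet_copies hA q)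
    (measurableSet_copies MeasurableSet.univ p) hP h
  simpa only [copies_inter_preimage, univ_inter] using this

theorem emb_of_subset_compl_atMost (hA : MeasurableSet A)
    (hP : ∀ (g : G), ∀ x ∈ P, g • x ∈ P) (h : P ⊆ (atMost G q A p)ᶜ) :
    Emb G (copies p P) (copies q (A ∩ P)) := by
  have := emb_of_subset_compl_fullyMatched G (measurableSet_copies hA q)
    (measurableSet_copies MeasurableSet.univ p) hP h
  simpa only [copies_inter_preimage, univ_inter] using
    this.mono subset_rfl (inter_subset_inter_left _ (matchedDom_subset _ _ _))

/-- Where an embedding exists, the greedy matching succeeds outside a compressible set. -/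
theorem isNull_of_emb_of_subset_compl_atMost (hA : MeasurableSet A) (hPm : MeasurableSet P)
    (hP : ∀ (g : G), ∀ x ∈ P, g • x ∈ P) (h : P ⊆ (atMost G q A p)ᶜ)
    (hemb : Emb G (copies q (A ∩ P)) (copies p P)) : IsNull G P := by
  have hcA := measurableSet_copies hA q
  have hcu := measurableSet_copies (MeasurableSet.univ : MeasurableSet (univ : Set X)) p
  have hback := emb_of_subset_compl_fullyMatched G hcA hcu hP h
  rw [copies_inter_preimage, univ_inter] at hback
  -- Following the given embedding by the greedy matching read backwards lands in the matched part
  -- of the source, so it misses the unmatched points, which occur over every orbit in P.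
  refine isNull_of_proper_self_emb hPm hP (S := copies q (A ∩ P))
    (D := copies q (A ∩ P) \ matchedDom (move G X) (copies q A) (copies p univ))
    ((measurableSet_copies (hA.inter hPm) q).diff (measurableSet_matchedDom_move G hcA hcu))
    sdiff_subset ?_ (hemb.trans hback) (fun x hx => ?_) hemb
  · intro z hz
    refine ⟨?_, fun h => h.2 hz.1⟩
    rw [← copies_inter_preimage]
    exact ⟨matchedDom_subset _ _ _ hz.1, hz.2⟩
  · have := h hx
    simp only [atMost, fullyMatched, mem_compl_iff, mem_ofPred_eq, not_forall] at this
    obtain ⟨g, i, hgi, hn⟩ := this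
    exact ⟨g, i, ⟨⟨hgi.1, hP g x hx⟩, hgi.2⟩, hn⟩

end Atmost

/-! ### The density and its pointwise properties -/

section Density

variable (G : Type*) {X : Type*} [Group G] [Countable G] [MulAction G X]

theorem mem_atMost_self (q : ℕ) (A : Set X) (x : X) : x ∈ atMost G q A q := fun g i h => by
  rwa [matchedDom_eq_of_subset _ _ _ (move_zero G X) (copies_mono (subset_univ A) le_rfl)]

/-- If p < q, stage 0 fills all p target levels from the same source levels, so the source level p
stays unmatched. -/
theorem le_of_mem_atMost_univ {q p : ℕ} {x : X} (h : x ∈ atMost G q univ p) : q ≤ p := by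
  by_contra! hlt
  have := matchedDom_subset_of_subset _ _ _ (move_zero G X)
    (copies_mono (subset_refl (univ : Set X)) hlt.le) (h 1 p ⟨mem_univ _, hlt⟩)
  exact lt_irrefl _ this.2

theorem atMost_anti {q p : ℕ} {A B : Set X} (h : A ⊆ B) : atMost G q B p ⊆ atMost G q A p :=
  fun _ hx g i hgi => matchedDom_anti_left _ _ (copies_mono h le_rfl)
    ⟨hx g i (copies_mono h le_rfl hgi), hgi⟩

open Classical in
/-- The relative size of `A` on the orbit of `x`: the infimum of the fractions `p / q` such that
`q` copies of `A` are matched greedily into `p` copies of the space. -/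
noncomputable def density (A : Set X) (x : X) : ℝ :=
  -- The shift keeps denominators positive. The cap and the default value 1 do not alter the
  -- infimum, since one copy of A always fits into one copy of the space.
  ⨅ k : ℕ × ℕ, if x ∈ atMost G (k.1 + 1) A k.2 then min 1 ((k.2 : ℝ) / (k.1 + 1 : ℕ)) else 1

theorem density_bddBelow (A : Set X) (x : X) [∀ q p, Decidable (x ∈ atMost G q A p)] :
    BddBelow (range fun k : ℕ × ℕ =>
      if x ∈ atMost G (k.1 + 1) A k.2 then min 1 ((k.2 : ℝ) / (k.1 + 1 : ℕ)) else 1) := by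
  refine ⟨0, ?_⟩
  rintro _ ⟨k, rfl⟩
  dsimp only
  split_ifs <;> positivity

theorem density_nonneg (A : Set X) (x : X) : 0 ≤ density G A x :=
  le_ciInf fun k => by split_ifs <;> positivity

theorem density_le {q p : ℕ} (hq : 0 < q) {A : Set X} {x : X} (h : x ∈ atMost G q A p) :
    density G A x ≤ (p : ℝ) / q := by
  classical
  obtain ⟨q, rfl⟩ := Nat.exists_eq_add_of_lt hq
  rw [zero_add] at h ⊢
  refine (ciInf_le (density_bddBelow G A x) (q, p)).trans ?_
  dsimp only
  rw [if_pos h]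
  exact min_le_right _ _

theorem density_le_one (A : Set X) (x : X) : density G A x ≤ 1 := by
  simpa using density_le G one_pos (mem_atMost_self G 1 A x)

theorem exists_of_density_lt {A : Set X} {x : X} {r : ℝ} (h : density G A x < r) :
    ∃ q p : ℕ, 0 < q ∧ x ∈ atMost G q A p ∧ (p : ℝ) / q < r := by
  classical
  obtain ⟨⟨q, p⟩, hk⟩ := exists_lt_of_ciInf_lt h
  dsimp only at hk
  have hone : 1 < r → ∃ q p : ℕ, 0 < q ∧ x ∈ atMost G q A p ∧ (p : ℝ) / q < r := fun h =>
    ⟨1, 1, one_pos, mem_atMost_self G 1 A x, by simpa using h⟩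
  split_ifs at hk with hm
  · rcases min_lt_iff.1 hk with h1 | h1
    · exact hone h1
    · exact ⟨q + 1, p, q.succ_pos, hm, h1⟩
  · exact hone hk

theorem density_mono {A B : Set X} (h : A ⊆ B) (x : X) : density G A x ≤ density G B x := by
  refine le_of_forall_gt fun r hr => ?_
  obtain ⟨q, p, hq, hx, hlt⟩ := exists_of_density_lt G hr
  exact (density_le G hq (atMost_anti G h hx)).trans_lt hlt

theorem density_univ (x : X) : density G univ x = 1 := by
  refine (density_le_one G _ x).antisymm (le_of_forall_gt fun r hr => ?_)
  obtain ⟨q, p, hq, hx, hlt⟩ := exists_of_density_lt G hr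
  refine lt_of_le_of_lt ?_ hlt
  rw [one_le_div (by positivity)]
  exact_mod_cast le_of_mem_atMost_univ G hx

theorem density_eq_zero {A : Set X} {x : X} (h : ∀ g : G, g • x ∉ A) : density G A x = 0 := by
  refine le_antisymm ?_ (density_nonneg G A x)
  simpa using density_le G one_pos (x := x) (A := A) (p := 0)
    (fun g i hgi => absurd hgi.1 (h g))

/-- The greedy matching consults only memberships along moves, so it commutes with preimages under
equivariant maps. This permits passing to the universal space. -/
theorem density_preimage {Y : Type*} [MulAction G Y] (f : X → Y)
    (hf : ∀ (g : G) x, f (g • x) = g • f x) (A : Set Y) (x : X) :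
    density G (f ⁻¹' A) x = density G A (f x) := by
  have key : ∀ q p, x ∈ atMost G q (f ⁻¹' A) p ↔ f x ∈ atMost G q A p := by
    intro q p
    have h1 : copies q (f ⁻¹' A) = Prod.map f id ⁻¹' copies q A := rfl
    have h2 : copies p (univ : Set X) = Prod.map f id ⁻¹' copies p univ := rfl
    simp only [atMost, fullyMatched, mem_ofPred_eq]
    rw [h1, h2, matchedDom_preimage (move G Y) _ _ (move G X) _ (move_equivariant G hf)]
    simp [hf]
  classical
  exact iInf_congr fun k => if_congr (key _ _) rfl rfl

variable [MeasurableSpace X] [MeasurableConstSMul G X]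

theorem measurable_density {A : Set X} (hA : MeasurableSet A) : Measurable (density G A) := by
  classical
  refine Measurable.iInf fun k => Measurable.ite ?_ measurable_const measurable_const
  exact measurableSet_atMost G _ hA _

end Density

/-! ### Invariance and additivity outside null sets -/

section Exceptional

variable {G X : Type*} [Group G] [Countable G] [MulAction G X] [MeasurableSpace X]
  [MeasurableConstSMul G X]

/-- Translation by g⁻¹ embeds copies of the translate into copies of A, so on the set in question an
embedding exists where the greedy matching fails. -/
theorem isNull_smul {A : Set X} (hA : MeasurableSet A) (g : G) (q p : ℕ) :
    IsNull G (atMost G q A p ∩ (atMost G q (g • A) p)ᶜ) := by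
  set P := atMost G q A p ∩ (atMost G q (g • A) p)ᶜ with hPdef
  have hgA : MeasurableSet (g • A) := hA.const_smul g
  have hP : ∀ (g : G), ∀ x ∈ P, g • x ∈ P := fun h x hx =>
    ⟨smul_mem_atMost G _ _ _ h x hx.1, smul_mem_compl_atMost G _ _ _ h x hx.2⟩
  have hPm : MeasurableSet P :=
    (measurableSet_atMost G q hA p).inter (measurableSet_atMost G q hgA p).compl
  refine isNull_of_emb_of_subset_compl_atMost hgA hPm hP inter_subset_right
    (Emb.trans ?_ (emb_of_subset_atMost hA hP inter_subset_left))
  refine ⟨fun z => (g⁻¹ • z.1, z.2), ((measurable_const_smul g⁻¹).comp measurable_fst).prodMk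
    measurable_snd, fun z hz => ⟨⟨mem_smul_set_iff_inv_smul_mem.1 hz.1.1, hP _ _ hz.1.2⟩, hz.2⟩,
    fun z _ w _ hzw => ?_, fun z _ => ⟨g⁻¹, rfl⟩⟩
  exact Prod.ext (smul_left_cancel _ (Prod.ext_iff.1 hzw).1) (Prod.ext_iff.1 hzw).2

theorem exists_isNull_density_smul {A : Set X} (hA : MeasurableSet A) :
    ∃ W, IsNull G W ∧ ∀ x ∉ W, ∀ g : G, density G A x = density G (g • A) x := by
  have key : ∀ g h : G, ∃ W, IsNull G W ∧ ∀ x ∉ W,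
      density G (g • h • A) x ≤ density G (h • A) x := by
    intro g h
    refine ⟨⋃ k : ℕ × ℕ, atMost G k.1 (h • A) k.2 ∩ (atMost G k.1 (g • h • A) k.2)ᶜ,
      IsNull.iUnion_countable fun k => isNull_smul (hA.const_smul h) g k.1 k.2,
      fun x hx => le_of_forall_gt fun r hr => ?_⟩
    obtain ⟨q, p, hq, hxm, hlt⟩ := exists_of_density_lt G hr
    refine (density_le G hq (p := p) ?_).trans_lt hlt
    by_contra hn
    exact hx (mem_iUnion.2 ⟨(q, p), hxm, hn⟩)
  choose W hW hW' using key
  refine ⟨⋃ p : G × G, W p.1 p.2, IsNull.iUnion_countable fun p => hW p.1 p.2,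
    fun x hx g => le_antisymm ?_ ?_⟩
  · simpa using hW' g⁻¹ g x fun h => hx (mem_iUnion.2 ⟨(g⁻¹, g), h⟩)
  · simpa using hW' g 1 x fun h => hx (mem_iUnion.2 ⟨(g, 1), h⟩)

theorem isNull_subadditive {A B : Set X} (hA : MeasurableSet A) (hB : MeasurableSet B)
    (q p q' p' : ℕ) :
    IsNull G (atMost G q A p ∩ atMost G q' B p' ∩
      (atMost G (q * q') (A ∪ B) (p * q' + p' * q))ᶜ) := by
  set P := atMost G q A p ∩ atMost G q' B p' ∩
      (atMost G (q * q') (A ∪ B) (p * q' + p' * q))ᶜ with hPdef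
  have hP : ∀ (g : G), ∀ x ∈ P, g • x ∈ P := fun h x hx =>
    ⟨⟨smul_mem_atMost G _ _ _ h x hx.1.1, smul_mem_atMost G _ _ _ h x hx.1.2⟩,
      smul_mem_compl_atMost G _ _ _ h x hx.2⟩
  have hPm : MeasurableSet P := ((measurableSet_atMost G q hA p).inter
    (measurableSet_atMost G q' hB p')).inter (measurableSet_atMost G _ (hA.union hB) _).compl
  refine isNull_of_emb_of_subset_compl_atMost (hA.union hB) hPm hP inter_subset_right ?_
  have h1 := (emb_of_subset_atMost hA hP (q := q) (p := p) fun x hx => hx.1.1).copies_mul q'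
  have h2 := (emb_of_subset_atMost hB hP (q := q') (p := p') fun x hx => hx.1.2).copies_mul q
  rw [mul_comm q' q] at h2
  rw [union_inter_distrib_right]
  exact Emb.copies_union (hA.inter hPm) h1 h2

/-- After clearing denominators, the lower bounds for A and B and the upper bound for their union
compose to an embedding of more copies of the set into fewer. -/
theorem isNull_superadditive {A B : Set X} (hA : MeasurableSet A) (hB : MeasurableSet B)
    (hAB : Disjoint A B) {q p q' p' Q R : ℕ} (hlt : R * (q * q') < (p * q' + p' * q) * Q) :
    IsNull G ((atMost G q A p)ᶜ ∩ (atMost G q' B p')ᶜ ∩ atMost G Q (A ∪ B) R) := by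
  set P := (atMost G q A p)ᶜ ∩ (atMost G q' B p')ᶜ ∩ atMost G Q (A ∪ B) R with hPdef
  have hP : ∀ (g : G), ∀ x ∈ P, g • x ∈ P := fun h x hx =>
    ⟨⟨smul_mem_compl_atMost G _ _ _ h x hx.1.1, smul_mem_compl_atMost G _ _ _ h x hx.1.2⟩,
      smul_mem_atMost G _ _ _ h x hx.2⟩
  have hPm : MeasurableSet P := ((measurableSet_atMost G q hA p).compl.inter
    (measurableSet_atMost G q' hB p').compl).inter (measurableSet_atMost G _ (hA.union hB) _)
  refine isNull_of_emb_copies_lt hPm hP hlt ?_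
  have h1 := (emb_of_subset_compl_atMost hA hP (q := q) (p := p) fun x hx => hx.1.1).copies_mul q'
  have h2 := (emb_of_subset_compl_atMost hB hP (q := q') (p := p')
    fun x hx => hx.1.2).copies_mul q
  rw [mul_comm q' q] at h2
  have h3 := (Emb.copies_add (hAB.mono inter_subset_left inter_subset_left) h1 h2).copies_mul Q
  have h4 := (emb_of_subset_atMost (hA.union hB) hP (q := Q) (p := R)
    fun x hx => hx.2).copies_mul (q * q')
  rw [mul_comm Q] at h4
  rw [← union_inter_distrib_right] at h3
  exact h3.trans h4

theorem exists_nat_div_btwn {s t : ℝ} (hs : 0 ≤ s) (hst : s < t) :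
    ∃ q p : ℕ, 0 < q ∧ s < (p : ℝ) / q ∧ (p : ℝ) / q < t := by
  obtain ⟨r, h1, h2⟩ := exists_rat_btwn hst
  have hr : 0 ≤ r := by exact_mod_cast hs.trans h1.le
  have : (r : ℝ) = (r.num.toNat : ℝ) / r.den := by
    rw [Rat.cast_def, ← Int.cast_natCast (R := ℝ) r.num.toNat, Int.toNat_of_nonneg
      (Rat.num_nonneg.2 hr)]
  exact ⟨r.den, r.num.toNat, r.den_pos, this ▸ h1, this ▸ h2⟩

theorem exists_isNull_density_union {A B : Set X} (hA : MeasurableSet A) (hB : MeasurableSet B)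
    (hAB : Disjoint A B) :
    ∃ W, IsNull G W ∧ ∀ x ∉ W, density G (A ∪ B) x = density G A x + density G B x := by
  let ι := {k : (ℕ × ℕ) × (ℕ × ℕ) × (ℕ × ℕ) //
    k.2.2.2 * (k.1.1 * k.2.1.1) < (k.1.2 * k.2.1.1 + k.2.1.2 * k.1.1) * k.2.2.1}
  have : Nonempty ι := ⟨⟨((1, 1), (1, 1), (1, 0)), by simp⟩⟩
  refine ⟨(⋃ k : (ℕ × ℕ) × (ℕ × ℕ), atMost G k.1.1 A k.1.2 ∩ atMost G k.2.1 B k.2.2 ∩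
      (atMost G (k.1.1 * k.2.1) (A ∪ B) (k.1.2 * k.2.1 + k.2.2 * k.1.1))ᶜ) ∪
    ⋃ k : ι, (atMost G k.1.1.1 A k.1.1.2)ᶜ ∩ (atMost G k.1.2.1.1 B k.1.2.1.2)ᶜ ∩
      atMost G k.1.2.2.1 (A ∪ B) k.1.2.2.2,
    (IsNull.iUnion_countable fun k => isNull_subadditive hA hB _ _ _ _).union
      (IsNull.iUnion_countable fun k => isNull_superadditive hA hB hAB k.2), fun x hx => ?_⟩
  rw [mem_union, not_or] at hx
  refine le_antisymm (not_lt.1 fun hlt => ?_) (not_lt.1 fun hlt => ?_)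
  -- The two thresholds exceed the densities of A and B and add up to the density of the union.
  · obtain ⟨q, p, hq, hxA, h1⟩ := exists_of_density_lt G
      (show density G A x < (density G A x + (density G (A ∪ B) x - density G B x)) / 2 by
        linarith)
    obtain ⟨q', p', hq', hxB, h2⟩ := exists_of_density_lt G
      (show density G B x < (density G B x + (density G (A ∪ B) x - density G A x)) / 2 by
        linarith)
    have hxU : x ∈ atMost G (q * q') (A ∪ B) (p * q' + p' * q) := by
      by_contra hn
      exact hx.1 (mem_iUnion.2 ⟨((q, p), (q', p')), ⟨hxA, hxB⟩, hn⟩)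
    have h3 := density_le G (Nat.mul_pos hq hq') hxU
    have h4 : ((p * q' + p' * q : ℕ) : ℝ) / (q * q' : ℕ) = (p : ℝ) / q + (p' : ℝ) / q' := by
      push_cast
      field_simp
    rw [h4] at h3
    linarith
  · have hA0 : 0 < density G A x := by
      have := density_mono G (subset_union_right (s := A) (t := B)) x
      linarith
    have hB0 : 0 < density G B x := by
      have := density_mono G (subset_union_left (s := A) (t := B)) x
      linarith
    obtain ⟨Q, R, hQ, hxU, h1⟩ := exists_of_density_lt G hlt
    -- δ is half of the defect: each fraction below loses less than δ, so their sum still exceeds R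
    -- / Q.
    have hδ : 0 < (density G A x + density G B x - (R : ℝ) / Q) / 2 := by linarith
    set δ := (density G A x + density G B x - (R : ℝ) / Q) / 2 with hδdef
    obtain ⟨q, p, hq, ha1, ha2⟩ := exists_nat_div_btwn (le_max_left 0 (density G A x - δ))
      (max_lt hA0 (by linarith))
    obtain ⟨q', p', hq', hb1, hb2⟩ := exists_nat_div_btwn (le_max_left 0 (density G B x - δ))
      (max_lt hB0 (by linarith))
    have ha3 := (le_max_right _ _).trans_lt ha1
    have hb3 := (le_max_right _ _).trans_lt hb1
    have hsum : (R : ℝ) / Q < (p : ℝ) / q + (p' : ℝ) / q' := by linarith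
    rw [div_add_div _ _ (by positivity) (by positivity), div_lt_div_iff₀ (by positivity)
      (by positivity)] at hsum
    have hnat : R * (q * q') < (p * q' + q * p') * Q := by exact_mod_cast hsum
    rw [mul_comm q p'] at hnat
    exact hx.2 (mem_iUnion.2 ⟨⟨((q, p), (q', p'), (Q, R)), hnat⟩,
      ⟨fun h => (density_le G hq h).not_gt ha2, fun h => (density_le G hq' h).not_gt hb2⟩, hxU⟩)

end Exceptional

/-! ### Positivity on the saturation -/

section Positivity

variable (G : Type*) {X : Type*} [Group G] [Countable G] [MulAction G X]

/-- What remains of the space after `k` successive greedy matchings of `A` into it. -/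
def remainder (A : Set X) : ℕ → Set X
  | 0 => univ
  | k + 1 => remainder A k \
      {x | (x, 0) ∈ matchedRan (move G X) (copies 1 A) (copies 1 (remainder A k))}

variable {A : Set X}

theorem remainder_anti : Antitone (remainder G A) :=
  antitone_nat_of_succ_le fun _ => sdiff_subset

variable [MeasurableSpace X] [MeasurableConstSMul G X]

theorem measurableSet_remainder (hA : MeasurableSet A) (k : ℕ) :
    MeasurableSet (remainder G A k) := by
  induction k with
  | zero => exact MeasurableSet.univ
  | succ k ih =>
    exact ih.diff ((measurable_id.prodMk measurable_const)
      (measurableSet_matchedRan_move G (measurableSet_copies hA 1) (measurableSet_copies ih 1)))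

variable {G}

theorem emb_compl_remainder (hA : MeasurableSet A) (k : ℕ) :
    Emb G (copies 1 (remainder G A k)ᶜ) (copies k A) := by
  induction k with
  | zero => exact Emb.of_subset fun z hz => absurd (mem_univ z.1) hz.1
  | succ k ih =>
    have hk := measurableSet_remainder G hA k
    have hcompl : (remainder G A (k + 1))ᶜ ⊆
        (remainder G A k)ᶜ ∪ (remainder G A k \ remainder G A (k + 1)) := fun x hx => by
      by_cases h : x ∈ remainder G A k
      · exact Or.inr ⟨h, hx⟩
      · exact Or.inl h
    refine (Emb.copies_union hk.compl ih ?_).mono (copies_mono hcompl le_rfl) subset_rfl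
    refine (emb_matchedRan G (measurableSet_copies hA 1) (measurableSet_copies hk 1)).mono
      ?_ (matchedDom_subset _ _ _)
    rintro ⟨x, i⟩ ⟨hx, hi⟩
    obtain rfl : i = 0 := Nat.lt_one_iff.1 hi
    by_contra hn
    exact hx.2 ⟨hx.1, hn⟩

theorem emb_remainder (hA : MeasurableSet A) (k : ℕ) :
    Emb G (matchedDom (move G X) (copies 1 A) (copies 1 (remainder G A k)))
      (copies 1 (remainder G A k \ remainder G A (k + 1))) := by
  refine (emb_matchedDom G (measurableSet_copies hA 1)
    (measurableSet_copies (measurableSet_remainder G hA k) 1)).mono subset_rfl ?_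
  rintro ⟨x, i⟩ hx
  have hx' := matchedRan_subset _ _ _ hx
  obtain rfl : i = 0 := Nat.lt_one_iff.1 hx'.2
  exact ⟨⟨hx'.1, fun h => h.2 hx⟩, hx'.2⟩

/-- Where one of the successive matchings of `A` fails, `A` is not too small. -/
theorem isNull_atMost_of_not_fullyMatched (hA : MeasurableSet A) {k q p : ℕ}
    (h : p * (k + 1) < q) :
    IsNull G ((fullyMatched G (copies 1 A) (copies 1 (remainder G A k)))ᶜ ∩ atMost G q A p) := by
  set P := (fullyMatched G (copies 1 A) (copies 1 (remainder G A k)))ᶜ ∩ atMost G q A p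
  have hk := measurableSet_remainder G hA k
  have hP : ∀ (g : G), ∀ x ∈ P, g • x ∈ P := fun g x hx =>
    ⟨fun hn => hx.1 ((smul_mem_iff (smul_mem_fullyMatched G _ _) g x).1 hn),
      smul_mem_atMost G _ _ _ g x hx.2⟩
  have hPm : MeasurableSet P := (measurableSet_fullyMatched G (measurableSet_copies hA 1)
    (measurableSet_copies hk 1)).compl.inter (measurableSet_atMost G q hA p)
  refine isNull_of_emb_copies_lt hPm hP h ?_
  -- Where the matching fails, the remainder fits into one copy of A; its complement fits into k
  -- copies. Hence P fits into k + 1 copies of A, and q copies of P fit into p (k + 1) < q copies.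
  have h1 := emb_of_subset_compl_fullyMatched G (measurableSet_copies hA 1)
    (measurableSet_copies hk 1) hP inter_subset_left
  replace h1 := h1.mono subset_rfl (inter_subset_inter_left _ (matchedDom_subset _ _ _))
  have h2 := (emb_compl_remainder hA k).restrict hP
  rw [copies_inter_preimage, copies_inter_preimage] at h1 h2
  have h3 := Emb.copies_union (hk.compl.inter hPm) h2 h1
  rw [← union_inter_distrib_right, compl_union_self, univ_inter] at h3
  have h4 := h3.copies_mul q
  have h5 := (emb_of_subset_atMost hA hP (q := q) (p := p) inter_subset_right).copies_mul (k + 1)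
  rw [one_mul, mul_comm (k + 1) q] at h4
  exact h4.trans h5

/-- If all the successive matchings of `A` succeed on orbits that meet `A`, these orbits are
compressible. -/
theorem isNull_forall_fullyMatched (hA : MeasurableSet A) :
    IsNull G ((⋃ g : G, (g • ·) ⁻¹' A) ∩
      ⋂ k, fullyMatched G (copies 1 A) (copies 1 (remainder G A k))) := by
  set P := (⋃ g : G, (g • ·) ⁻¹' A) ∩
      ⋂ k, fullyMatched G (copies 1 A) (copies 1 (remainder G A k))
  have hP : ∀ (g : G), ∀ x ∈ P, g • x ∈ P := fun g x hx => by
    refine ⟨?_, mem_iInter.2 fun k => smul_mem_fullyMatched G _ _ g x (mem_iInter.1 hx.2 k)⟩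
    obtain ⟨h, hh⟩ := mem_iUnion.1 hx.1
    exact mem_iUnion.2 ⟨h * g⁻¹, by simpa [mul_smul] using hh⟩
  have hPm : MeasurableSet P :=
    (MeasurableSet.iUnion fun g => (measurable_const_smul g) hA).inter
      (MeasurableSet.iInter fun k => measurableSet_fullyMatched G (measurableSet_copies hA 1)
        (measurableSet_copies (measurableSet_remainder G hA k) 1))
  refine IsNull.of_emb_two hPm hP ?_
  choose θ hm hmap hinj ho using fun k => emb_remainder (G := G) hA k
  obtain ⟨a, ha⟩ := exists_surjective_nat G
  obtain ⟨ν, hν, hν'⟩ := exists_measurable_index (fun n => (fun x : X => a n • x) ⁻¹' A)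
    (fun n => (measurable_const_smul (a n)) hA)
  have hmem : ∀ x ∈ P, ∀ k, (a (ν x) • x, 0) ∈
      matchedDom (move G X) (copies 1 A) (copies 1 (remainder G A k)) := fun x hx k => by
    refine mem_iInter.1 hx.2 k _ 0 ⟨hν' x ?_, one_pos⟩
    obtain ⟨g, hg⟩ := mem_iUnion.1 hx.1
    obtain ⟨n, rfl⟩ := ha g
    exact mem_iUnion.2 ⟨n, hg⟩
  have horb : ∀ x ∈ P, ∀ k, ∃ g : G, (θ k (a (ν x) • x, 0)).1 = g • x := fun x hx k => by
    obtain ⟨g, hg⟩ := ho k _ (hmem x hx k)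
    exact ⟨g * a (ν x), by rw [hg, mul_smul]⟩
  have hdisj : ∀ {j k : ℕ} {x : X}, x ∈ remainder G A j \ remainder G A (j + 1) →
      x ∈ remainder G A k \ remainder G A (k + 1) → j = k := by
    intro j k x hj hk
    rcases lt_trichotomy j k with h | h | h
    · exact absurd (remainder_anti G h hk.1) hj.2
    · exact h
    · exact absurd (remainder_anti G h hj.1) hk.2
  -- Each point is moved into A and then into one of the disjoint layers between successive
  -- remainders. The layer records the copy and the group element used.
  refine ⟨fun z => θ (Nat.pair z.2 (ν z.1)) (a (ν z.1) • z.1, 0), ?_, fun z hz => ⟨?_, ?_⟩,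
    fun z hz w hw hzw => ?_, fun z hz => horb z.1 hz.1 _⟩
  · have : Measurable fun p : (ℕ × ℕ) × X => θ (Nat.pair p.1.1 p.1.2) (a p.1.2 • p.2, 0) :=
      measurable_from_prod_countable_right fun p =>
        (hm (Nat.pair p.1 p.2)).comp ((measurable_const_smul (a p.2)).prodMk measurable_const)
    exact this.comp ((measurable_snd.prodMk (hν.comp measurable_fst)).prodMk measurable_fst)
  · obtain ⟨g, hg⟩ := horb z.1 hz.1 (Nat.pair z.2 (ν z.1))
    exact hg ▸ hP g _ hz.1
  · exact (hmap _ (hmem z.1 hz.1 _)).2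
  · have h1 := hmap (Nat.pair z.2 (ν z.1)) (hmem z.1 hz.1 _)
    have h2 := hmap (Nat.pair w.2 (ν w.1)) (hmem w.1 hw.1 _)
    simp only at hzw
    rw [← hzw] at h2
    have h3 := hdisj h1.1 h2.1
    obtain ⟨h4, h5⟩ := Nat.pair_eq_pair.1 h3
    rw [← h3] at hzw
    have h6 := hinj _ (hmem z.1 hz.1 _) (hmem w.1 hw.1 _) hzw
    rw [h5] at h6
    exact Prod.ext (smul_left_cancel _ (Prod.ext_iff.1 h6).1) h4

theorem exists_isNull_density_pos (hA : MeasurableSet A) :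
    ∃ W, IsNull G W ∧ ∀ x ∉ W, (∃ g : G, g • x ∈ A) → 0 < density G A x := by
  let ι := {k : ℕ × ℕ × ℕ // k.2.2 * (k.1 + 1) < k.2.1}
  have : Nonempty ι := ⟨⟨(0, 1, 0), by simp⟩⟩
  refine ⟨_, (isNull_forall_fullyMatched hA).union (IsNull.iUnion_countable fun k : ι =>
    isNull_atMost_of_not_fullyMatched hA k.2), fun x hx hg => ?_⟩
  rw [mem_union, not_or] at hx
  have hk : ∃ k, x ∉ fullyMatched G (copies 1 A) (copies 1 (remainder G A k)) := by
    by_contra! hall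
    exact hx.1 ⟨mem_iUnion.2 hg, mem_iInter.2 hall⟩
  obtain ⟨k, hk⟩ := hk
  by_contra hn
  -- Failure at step k bounds the density below by 1 / (k + 1) off the null sets.
  obtain ⟨q, p, hq, hxm, hlt⟩ := exists_of_density_lt G
    (lt_of_le_of_lt (not_lt.1 hn) (show (0 : ℝ) < 1 / (k + 1 : ℕ) by positivity))
  rw [div_lt_div_iff₀ (by positivity) (by positivity), one_mul] at hlt
  exact hx.2 (mem_iUnion.2 ⟨⟨(k, q, p), by exact_mod_cast hlt⟩, hk, hxm⟩)

end Positivity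

/-! ### Universal itineraries and transfer to the ideals -/

/-- The universal space for the itineraries of points with respect to two sets. -/
def Itinerary (G : Type*) : Type _ := G → Prop × Prop

namespace Itinerary

variable {G : Type*}

instance : MeasurableSpace (Itinerary G) := inferInstanceAs (MeasurableSpace (G → Prop × Prop))

theorem measurableSet_eq [Countable G] {f f' : Itinerary G → Itinerary G} (hf : Measurable f)
    (hf' : Measurable f') : MeasurableSet {y | f y = f' y} := by
  have : {y | f y = f' y} = ⋂ g : G, {y | f y g = f' y g} := by
    ext y
    simp only [mem_ofPred_eq, mem_iInter]
    exact funext_iff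
  rw [this]
  exact MeasurableSet.iInter fun g => measurableSet_eq_fun
    ((measurable_pi_apply g).comp hf) ((measurable_pi_apply g).comp hf')

variable [Group G]

/-- Translating the index on the right is what makes `itinerary` equivariant. -/
instance : MulAction G (Itinerary G) where
  smul g y := fun h => y (h * g)
  one_smul y := funext fun h => congrArg y (mul_one h)
  mul_smul g g' y := funext fun h => congrArg y (mul_assoc h g g').symm

theorem smul_apply (g h : G) (y : Itinerary G) : (g • y) h = y (h * g) := rfl

instance : MeasurableConstSMul G (Itinerary G) where
  measurable_const_smul g := measurable_pi_lambda _ fun h => measurable_pi_apply (h * g)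

/-- The universal first set. -/
def fstSet (G : Type*) [Group G] : Set (Itinerary G) := {y | (y 1).1}

/-- The universal second set. -/
def sndSet (G : Type*) [Group G] : Set (Itinerary G) := {y | (y 1).2}

theorem measurableSet_fstSet : MeasurableSet (fstSet G) :=
  measurableSet_setOfPred.2 (measurable_pi_apply (1 : G)).fst

theorem measurableSet_sndSet : MeasurableSet (sndSet G) :=
  measurableSet_setOfPred.2 (measurable_pi_apply (1 : G)).snd

end Itinerary

open Itinerary

variable {G X : Type*} [Group G] [MulAction G X]

/-- The itinerary of a point with respect to the sets `A` and `B`. -/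
def itinerary (G : Type*) {X : Type*} [Group G] [MulAction G X] (A B : Set X) (x : X) :
    Itinerary G := fun h => (h • x ∈ A, h • x ∈ B)

theorem itinerary_smul (A B : Set X) (g : G) (x : X) :
    itinerary G A B (g • x) = g • itinerary G A B x := by
  funext h
  simp [itinerary, Itinerary.smul_apply, mul_smul]

theorem preimage_fstSet (A B : Set X) : itinerary G A B ⁻¹' fstSet G = A := by
  ext x; simp [itinerary, fstSet]

theorem preimage_sndSet (A B : Set X) : itinerary G A B ⁻¹' sndSet G = B := by
  ext x; simp [itinerary, sndSet]

theorem preimage_smul_of_equivariant {Y : Type*} [MulAction G Y] {f : X → Y}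
    (hf : ∀ (g : G) x, f (g • x) = g • f x) (g : G) (A : Set Y) :
    f ⁻¹' (g • A) = g • f ⁻¹' A := by
  ext x; simp [mem_smul_set_iff_inv_smul_mem, hf]

theorem measurable_itinerary [MeasurableSpace X] [MeasurableConstSMul G X] {A B : Set X}
    (hA : MeasurableSet A) (hB : MeasurableSet B) : Measurable (itinerary G A B) :=
  measurable_pi_lambda _ fun h =>
    (measurableSet_setOfPred.1 (measurable_const_smul h hA)).prodMk
      (measurableSet_setOfPred.1 (measurable_const_smul h hB))

theorem mem_orbitSaturation {A : Set X} {x : X} :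
    x ∈ orbitSaturation G A ↔ ∃ g : G, g • x ∈ A := by
  constructor
  · rintro ⟨y, hy, g, rfl⟩
    exact ⟨g⁻¹, by simpa using hy⟩
  · rintro ⟨g, hg⟩
    exact ⟨g • x, hg, g⁻¹, by simp⟩

theorem isInvariantRelTo_preimage {Y : Type*} {E : Setoid X} {f : X → Y}
    (hE : ∀ x y, E x y → f x = f y) (D : Set Y) (A : Set X) :
    IsInvariantRelTo E (f ⁻¹' D) A := by
  refine congrArg (· ∩ A) (Subset.antisymm ?_ fun x hx => ⟨x, hx, E.refl x⟩)
  rintro x ⟨y, hy, hxy⟩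
  exact mem_preimage.2 (hE x y hxy ▸ hy)

/-- Preimages of compressible sets of itineraries belong to the ideals `C_i` for `i ≥ 3`. -/
theorem preimage_itinerary_mem_compressibleIdeal [Countable G] [Infinite G] [MeasurableSpace X]
    [MeasurableConstSMul G X] {A B : Set X} (hA : MeasurableSet A) (hB : MeasurableSet B)
    {W : Set (Itinerary G)} (hW : IsNull G W) {i : ℕ} (hi : 3 ≤ i) :
    itinerary G A B ⁻¹' W ∈ compressibleIdeal G X i := by
  obtain ⟨hWm, hWinv, θ, hm, hinj, ho, hc⟩ := hW
  set φ := itinerary G A B with hφdef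
  have hφ : Measurable φ := measurable_itinerary hA hB
  have hφg : ∀ (g : G) x, φ (g • x) = g • φ x := itinerary_smul A B
  obtain ⟨hden⟩ := nonempty_denumerable G
  let a : ℕ ≃ G := (Denumerable.eqv G).symm
  -- The compression is cut into pieces on which it acts by one group element, the first in the
  -- enumeration that agrees with it.
  let D : ℕ → Set (Itinerary G) := fun n =>
    (W ∩ {y | θ y = a n • y}) \ ⋃ k < n, {y | θ y = a k • y}
  have hEq : ∀ n, MeasurableSet {y : Itinerary G | θ y = a n • y} := fun n =>
    measurableSet_eq hm (measurable_const_smul (a n))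
  have hD : ∀ n, MeasurableSet (D n) := fun n => (hWm.inter (hEq n)).diff
    (MeasurableSet.iUnion fun k => MeasurableSet.iUnion fun _ => hEq k)
  have hDdisj : ∀ {n m y}, y ∈ D n → y ∈ D m → n = m := by
    intro n m y hn hm
    rcases lt_trichotomy n m with h | h | h
    · exact absurd (mem_iUnion₂.2 ⟨n, h, hn.1.2⟩) hm.2
    · exact h
    · exact absurd (mem_iUnion₂.2 ⟨m, h, hm.1.2⟩) hn.2
  have hDU : ⋃ n, D n = W := by
    classical
    refine Subset.antisymm (iUnion_subset fun n y hy => hy.1.1) fun y hy => ?_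
    have hex : ∃ n, θ y = a n • y := by
      obtain ⟨g, hg⟩ := ho y hy
      exact ⟨a.symm g, by simpa using hg⟩
    refine mem_iUnion.2 ⟨Nat.find hex, ⟨hy, Nat.find_spec hex⟩, fun h => ?_⟩
    obtain ⟨k, hk, hk'⟩ := mem_iUnion₂.1 h
    exact Nat.find_min hex hk hk'
  have hDθ : ∀ n, a n • D n = θ '' D n := fun n => image_congr fun y hy => hy.1.2.symm
  set B' : Set X := φ ⁻¹' (⋃ n, a n • D n) with hB'
  have hB'W : ⋃ n, a n • D n = θ '' W := by simp only [hDθ, ← image_iUnion, hDU]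
  have hθW : θ '' W ⊆ W := by
    rintro _ ⟨y, hy, rfl⟩
    obtain ⟨g, hg⟩ := ho y hy
    exact hg ▸ hWinv g y hy
  have hB'm : MeasurableSet B' := hφ (MeasurableSet.iUnion fun n => (hD n).const_smul (a n))
  have hB'P : B' ⊆ φ ⁻¹' W := preimage_mono (hB'W.trans_subset hθW)
  have hPinv : ∀ (g : G) x, x ∈ φ ⁻¹' W → g • x ∈ φ ⁻¹' W := fun g x hx =>
    mem_preimage.2 (hφg g x ▸ hWinv g _ hx)
  have hsat : orbitSaturation G (φ ⁻¹' W) = φ ⁻¹' W := by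
    ext x
    rw [mem_orbitSaturation]
    exact ⟨fun ⟨g, hg⟩ => (smul_mem_iff hPinv g x).1 hg, fun h => ⟨1, hPinv 1 x h⟩⟩
  -- A and B ensure that points with the same symbolic representation have the same itinerary, so
  -- all preimages under φ are relatively invariant; `B'` supplies the required trace and pads the
  -- family when i > 3.
  let F : Fin i → Set X := fun k => if (k : ℕ) = 0 then A else if (k : ℕ) = 1 then B else B'
  have hE : ∀ x y, notSeparated G (generatedPartition F) x y → φ x = φ y := by
    intro x y hxy
    funext g
    have h0 := hxy g ⟨0, by omega⟩
    have h1 := hxy g ⟨1, by omega⟩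
    simp only [F, if_true, one_ne_zero, if_false] at h0 h1
    exact Prod.ext (propext h0) (propext h1)
  refine ⟨φ ⁻¹' W, subset_rfl, hφ hWm, fun g => ?_, hφ hWm, B', hB'P, hB'm, ?_, F,
    ⟨fun k => ?_, ?_, ⟨a, fun n => φ ⁻¹' D n, fun n => φ ⁻¹' (a n • D n), ⟨?_, ?_⟩, ⟨?_, ?_⟩,
      fun n => ⟨(preimage_smul_of_equivariant hφg _ _).symm, hφ (hD n),
        hφ ((hD n).const_smul (a n)), isInvariantRelTo_preimage hE _ _,
        isInvariantRelTo_preimage hE _ _⟩⟩⟩, ⟨⟨2, by omega⟩, ?_⟩⟩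
  · ext x
    rw [mem_smul_set_iff_inv_smul_mem, smul_mem_iff hPinv]
  · rw [hsat]
    ext x
    rw [mem_orbitSaturation]
    refine ⟨fun ⟨g, hg⟩ => (smul_mem_iff hPinv g x).1 hg.1, fun hx => ?_⟩
    obtain ⟨g, hg⟩ := hc (φ x) hx
    refine ⟨g, hPinv g x hx, fun h => ?_⟩
    rw [hB', hB'W, mem_preimage, hφg] at h
    obtain ⟨y, hy, hyx⟩ := h
    exact hg y hy hyx
  · dsimp only [F]
    split_ifs <;> assumption
  · rw [IsSensitive, hsat]
    exact isInvariantRelTo_preimage hE _ _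
  · intro n m hnm
    refine Disjoint.preimage φ (disjoint_left.2 fun y hn hm => hnm (hDdisj hn hm))
  · rw [← preimage_iUnion, hDU]
  · intro n m hnm
    refine Disjoint.preimage φ (disjoint_left.2 fun y hn hm' => ?_)
    rw [hDθ] at hn hm'
    obtain ⟨z, hz, rfl⟩ := hn
    obtain ⟨w, hw, hzw⟩ := hm'
    exact hnm (hDdisj hz (hinj hw.1.1 hz.1.1 hzw ▸ hw))
  · rw [← preimage_iUnion]
  · rw [hsat]
    simpa [F] using hB'P

/-- Outside a compressible set of itineraries, the density is positive, invariant and additive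
for the two universal sets. -/
theorem exists_exceptional_set (G : Type*) [Group G] [Countable G] :
    ∃ W : Set (Itinerary G), IsNull G W ∧
      ∀ {X : Type _} [MulAction G X] (A B : Set X) (x : X), itinerary G A B x ∉ W →
        ((∃ g : G, g • x ∈ A) → 0 < density G A x) ∧
        (∀ g : G, density G A x = density G (g • A) x) ∧
        (Disjoint A B → density G (A ∪ B) x = density G A x + density G B x) := by
  obtain ⟨W₁, h₁, h₁'⟩ := exists_isNull_density_pos (G := G) (measurableSet_fstSet (G := G))
  obtain ⟨W₂, h₂, h₂'⟩ := exists_isNull_density_smul (G := G) (measurableSet_fstSet (G := G))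
  -- The two universal sets overlap, so the second is replaced by its difference with the first;
  -- this pulls back to B when A and B are disjoint.
  obtain ⟨W₃, h₃, h₃'⟩ := exists_isNull_density_union (G := G) (measurableSet_fstSet (G := G))
    (measurableSet_sndSet.diff measurableSet_fstSet) disjoint_sdiff_self_right
  refine ⟨W₁ ∪ W₂ ∪ W₃, (h₁.union h₂).union h₃, fun {X} _ A B x hx => ?_⟩
  simp only [mem_union, not_or] at hx
  have hpre := fun D : Set (Itinerary G) =>
    density_preimage G (itinerary G A B) (itinerary_smul A B) D x
  have hA := hpre (fstSet G)
  rw [preimage_fstSet] at hA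
  refine ⟨fun ⟨g, hg⟩ => hA ▸ h₁' _ hx.1.1 ⟨g, ?_⟩, fun g => ?_, fun hAB => ?_⟩
  · rw [← itinerary_smul]
    rwa [← preimage_fstSet (G := G) A B] at hg
  · rw [hA, h₂' _ hx.1.2 g, ← hpre, preimage_smul_of_equivariant (itinerary_smul A B),
      preimage_fstSet]
  · have h := h₃' _ hx.2
    rw [← hpre, ← hpre, ← hpre, preimage_union, preimage_sdiff, preimage_fstSet, preimage_sndSet,
      hAB.sdiff_eq_right] at h
    exact h

/-- Countably many exceptional sets are contained in a single one. -/
theorem iUnion_preimage_itinerary_subset [Countable G] [MeasurableSpace X]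
    [MeasurableConstSMul G X] {W : Set (Itinerary G)} (hW : IsNull G W) (A B : ℕ → Set X)
    (hA : ∀ n, MeasurableSet (A n)) (hB : ∀ n, MeasurableSet (B n)) :
    ∃ A' B' : Set X, MeasurableSet A' ∧ MeasurableSet B' ∧
      ⋃ n, itinerary G (A n) (B n) ⁻¹' W ⊆ itinerary G A' B' ⁻¹' W := by
  set P : ℕ → Set X := fun n => itinerary G (A n) (B n) ⁻¹' W
  have hP : ∀ n, MeasurableSet (P n) := fun n =>
    measurable_itinerary (hA n) (hB n) hW.measurableSet
  have hinv : ∀ n (g : G) x, g • x ∈ P n ↔ x ∈ P n := fun n =>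
    smul_mem_iff fun g x hx => by
      rw [mem_preimage, itinerary_smul]
      exact hW.smul_mem g _ hx
  have hdinv : ∀ n (g : G) x, g • x ∈ disjointed P n ↔ x ∈ disjointed P n := fun n g x => by
    simp only [disjointed_eq_inter_compl, mem_inter_iff, mem_iInter, mem_compl_iff, hinv]
  have hdisj : ∀ {i j x}, x ∈ disjointed P i → x ∈ disjointed P j → i = j := by
    intro i j x hi hj
    by_contra hij
    exact (disjoint_disjointed P hij).le_bot ⟨hi, hj⟩
  have hmem : ∀ (S : ℕ → Set X) n x (g : G), x ∈ disjointed P n →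
      (g • x ∈ ⋃ k, S k ∩ disjointed P k ↔ g • x ∈ S n) := by
    intro S n x g hx
    rw [mem_iUnion]
    constructor
    · rintro ⟨k, hk, hk'⟩
      rwa [hdisj hx ((hdinv k g x).1 hk')]
    · exact fun h => ⟨n, h, (hdinv n g x).2 hx⟩
  refine ⟨⋃ n, A n ∩ disjointed P n, ⋃ n, B n ∩ disjointed P n,
    MeasurableSet.iUnion fun n => (hA n).inter (MeasurableSet.disjointed hP n),
    MeasurableSet.iUnion fun n => (hB n).inter (MeasurableSet.disjointed hP n), ?_⟩
  rw [← iUnion_disjointed]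
  refine iUnion_subset fun n x hx => ?_
  -- The disjointed pieces are invariant, so along the whole orbit of x the glued sets agree with
  -- the n-th pair.
  have : itinerary G (⋃ n, A n ∩ disjointed P n) (⋃ n, B n ∩ disjointed P n) x =
      itinerary G (A n) (B n) x :=
    funext fun g => Prod.ext (propext (hmem A n x g hx)) (propext (hmem B n x g hx))
  rw [mem_preimage, this]
  exact disjointed_subset P n hx

end CompressibleAction

/-! ### The theorem -/

theorem mainTheorem5 (G X : Type*) [Group G] [Countable G] [Infinite G]
    [MeasurableSpace X] [StandardBorelSpace X] [MulAction G X] [MeasurableConstSMul G X] :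
    (CompressibleAction.IsAperiodic G X →
      ∃ m : Set X → X → ℝ,
        (∀ A, MeasurableSet A → ∀ x, m A x ∈ Set.Icc (0 : ℝ) 1) ∧
        (∀ A, MeasurableSet A → Measurable (m A)) ∧
        (∀ x, m Set.univ x = 1) ∧
        (∀ A B, MeasurableSet A → MeasurableSet B → A ⊆ B → ∀ x, m A x ≤ m B x) ∧
        (∀ A, MeasurableSet A → ∀ x, x ∉ CompressibleAction.orbitSaturation G A → m A x = 0) ∧
        (∀ A, MeasurableSet A →
          CompressibleAction.HoldsModulo (CompressibleAction.compressibleIdeal G X 4)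
            (fun x => x ∈ CompressibleAction.orbitSaturation G A → 0 < m A x)) ∧
        (∀ A, MeasurableSet A →
          CompressibleAction.HoldsModulo (CompressibleAction.compressibleIdeal G X 3)
            (fun x => ∀ g : G, m A x = m (g • A) x)) ∧
        (∀ A B, MeasurableSet A → MeasurableSet B → Disjoint A B →
          CompressibleAction.HoldsModulo (CompressibleAction.compressibleIdeal G X 4)
            (fun x => m (A ∪ B) x = m A x + m B x))) ∧
    (∀ 𝔅 : Set (Set X), 𝔅.Countable → CompressibleAction.IsBooleanGAlgebra G 𝔅 →
      ∀ A ∈ 𝔅, A ∉ CompressibleAction.compressibleIdeal G X 4 →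
        ∃ μ : Set X → ℝ, CompressibleAction.IsInvariantFinAddProb G 𝔅 μ ∧ 0 < μ A ∧
          ∃ x ∈ A, ∀ B ∈ 𝔅, B ∩ MulAction.orbit G x = ∅ → μ B = 0) := by
  open CompressibleAction in
  obtain ⟨W, hW, hWd⟩ := exists_exceptional_set G
  refine ⟨fun _ => ⟨density G, fun A _ x => ⟨density_nonneg G A x, density_le_one G A x⟩,
    fun A hA => measurable_density G hA, density_univ G, fun A B _ _ h x => density_mono G h x,
    fun A _ x hx => density_eq_zero G fun g hg => hx (mem_orbitSaturation.2 ⟨g, hg⟩),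
    fun A hA => ?_, fun A hA => ?_, fun A B hA hB hAB => ?_⟩, fun 𝔅 hc h𝔅 A hA hAC => ?_⟩
  · exact ⟨_, preimage_itinerary_mem_compressibleIdeal hA hA hW (by norm_num),
      fun x hx h => (hWd A A x hx).1 (mem_orbitSaturation.1 h)⟩
  · exact ⟨_, preimage_itinerary_mem_compressibleIdeal hA hA hW le_rfl,
      fun x hx => (hWd A A x hx).2.1⟩
  · exact ⟨_, preimage_itinerary_mem_compressibleIdeal hA hB hW (by norm_num),
      fun x hx => (hWd A B x hx).2.2 hAB⟩
  -- Additivity involves two sets at a time, so all pairs from the algebra are enumerated.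
  · obtain ⟨S, hS⟩ := (hc.prod hc).exists_eq_range ⟨(A, A), hA, hA⟩
    have hmem : ∀ n, (S n).1 ∈ 𝔅 ∧ (S n).2 ∈ 𝔅 := fun n => by
      have : S n ∈ 𝔅 ×ˢ 𝔅 := hS ▸ Set.mem_range_self n
      exact this
    obtain ⟨A', B', hA', hB', hsub⟩ := iUnion_preimage_itinerary_subset hW
      (fun n => (S n).1) (fun n => (S n).2) (fun n => h𝔅.measurableSet _ (hmem n).1)
      (fun n => h𝔅.measurableSet _ (hmem n).2)
    -- Otherwise A would lie in the pullback of one null set, which belongs to the ideal.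
    obtain ⟨x, hxA, hx⟩ : ∃ x ∈ A, x ∉ itinerary G A' B' ⁻¹' W := by
      by_contra! hall
      obtain ⟨P, hP, h⟩ := preimage_itinerary_mem_compressibleIdeal hA' hB' hW
        (show 3 ≤ 4 by norm_num)
      exact hAC ⟨P, fun x hx => hP (hall x hx), h⟩
    have hgood : ∀ B ∈ 𝔅, ∀ C ∈ 𝔅, itinerary G B C x ∉ W := fun B hB C hC h => by
      obtain ⟨n, hn⟩ : (B, C) ∈ Set.range S := hS ▸ Set.mk_mem_prod hB hC
      exact hx (hsub (Set.mem_iUnion.2 ⟨n, by simpa [hn] using h⟩))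
    refine ⟨fun B => density G B x, ⟨fun B _ => density_nonneg G B x, density_univ G x,
      fun B hB C hC hBC => (hWd B C x (hgood B hB C hC)).2.2 hBC,
      fun g B hB => ((hWd B B x (hgood B hB B hB)).2.1 g).symm⟩,
      (hWd A A x (hgood A hA A hA)).1 ⟨1, by simpa using hxA⟩, x, hxA, fun B _ hB => ?_⟩
    refine density_eq_zero G fun g hg => ?_
    have : g • x ∈ B ∩ MulAction.orbit G x := ⟨hg, g, rfl⟩
    rw [hB] at this
    exact this
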